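/- Let $0<R_1<R_2$, let $\Omega=\{(x,y,z)\in\mathbb{R}^3: R_1^2<x^2+y^2<R_2^2\}$, let $\Gamma_k=\{x^2+y^2=R_k^2\}$ $(k=1,2)$, and put $\rho=\sqrt{x^2+y^2}$, $e_\theta=(-y/\rho,x/\rho,0)$, $e_z=(0,0,1)$. Consider the still-outer-cylinder Dirichlet problem for the steady Navier–Stokes equations $$-\Delta u+u\cdot\nabla u+\nabla p=0,\quad \nabla\cdot u=0\ \text{ in }\Omega,\qquad u=\alpha e_\theta\ \text{ on }\Gamma_1,\quad u=0\ \text{ on }\Gamma_2, \tag{1}$$ where solutions are understood in the weak sense: $u\in H^1_{\rm loc}(\Omega;\mathbb{R}^3)$ and $p\in L^1_{\rm loc}(\Omega)$ satisfy the equations in the sense of distributions, and the boundary values are attained in the sense of traces (there is $G\in C^\infty(\mathbb{R}^3;\mathbb{R}^3)$ with $G=\alpha e_\theta$ on $\Gamma_1$, $G=0$ on $\Gamma_2$, and $\chi(u-G)\in H^1_0(\Omega;\mathbb{R}^3)$ for all $\chi\in C_c^\infty(\mathbb{R}^3)$). For $\alpha,\beta\in\mathbb{R}$ the spiral Poiseuille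 flow is $$\mathcal U_{\alpha,\beta}=\alpha\,\frac{R_1}{R_2^2-R_1^2}\Big(\frac{R_2^2}{\rho}-\rho\Big)e_\theta+\frac{\beta}{4}\Big(\rho^2-R_1^2-\frac{R_2^2-R_1^2}{\log(R_2/R_1)}\log\frac{\rho}{R_1}\Big)e_z,$$ $$\mathcal P_{\alpha,\beta}=\frac{\alpha^2}{2}\Big(\frac{R_1}{R_2^2-R_1^2}\Big)^2\Big(\rho^2-\frac{R_2^4}{\rho^2}-4R_2^2\log\rho\Big)+\beta z .$$ Let $V_0(\Omega)=\{v\in H^1_0(\Omega;\mathbb{R}^3):\nabla\cdot v=0\text{ in }\Omega\}$, where $H_0^1(\Omega;\mathbb{R}^3)$ is the closure of $C_c^\infty(\Omega;\mathbb{R}^3)$ in $H^1(\Omega;\mathbb{R}^3)$, and let $$\Lambda(\Omega)=\inf_{v\in V_0(\Omega)\setminus\{0\}}\frac{\|\nabla v\|_{L^2(\Omega)}^2}{\|v\|_{L^2(\Omega)}^2},$$ $$M_{\rm out}(\alpha,\beta)=\left[\alpha^2\frac{R_2^4}{(R_2^2-R_1^2)^2R_1^2}+\frac{\beta^2}{16}\Big(\frac{R_2^2-R_1^2}{R_1\log(R_2^2/R_1^2)}-R_1\Big)^2\right]^{1/2}.$$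 **Theorem 3.3 (uniqueness).** Fix $\alpha,\beta\in\mathbb{R}$ and let $(v,q)\in V_0(\Omega)\times L^2(\Omega)$ be such that $(\mathcal U_{\alpha,\beta}+v,\ \mathcal P_{\alpha,\beta}+q)$ solves (1). If $M_{\rm out}(\alpha,\beta)<\Lambda(\Omega)$, then $(v,q)=(0,0)$ a.e. in $\Omega$. In particular, $(v,q)=(0,0)$ a.e. in $\Omega$ whenever $$M_{\rm out}(\alpha,\beta)<\max\left\{\frac{\pi^2}{2R_2^2},\ \frac{8}{(R_2^2-R_1^2)\log(R_2/R_1)}\right\}.$$ -/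

import Mathlib

open MeasureTheory Filter Topology
open scoped ContDiff

namespace SpiralPoiseuille

/-- Three-dimensional Euclidean space, with Cartesian coordinates `x 0, x 1, x 2` (that is,
`x, y, z`). -/
abbrev E3 : Type := EuclideanSpace ℝ (Fin 3)

/-- The distance `ρ = √(x² + y²)` to the vertical axis. -/
noncomputable def rho (x : E3) : ℝ := Real.sqrt (x 0 ^ 2 + x 1 ^ 2)

/-- The unbounded cylindrical annulus `R₁² < x² + y² < R₂²`, `z ∈ ℝ`. -/
def annulus (R₁ R₂ : ℝ) : Set E3 :=
  {x | R₁ ^ 2 < x 0 ^ 2 + x 1 ^ 2 ∧ x 0 ^ 2 + x 1 ^ 2 < R₂ ^ 2}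

/-- The cylindrical surface `x² + y² = R²`, `z ∈ ℝ`. -/
def cylinder (R : ℝ) : Set E3 := {x | x 0 ^ 2 + x 1 ^ 2 = R ^ 2}

/-- The azimuthal unit vector `e_θ = (-sin θ, cos θ, 0)` at a point off the vertical axis. -/
noncomputable def eTheta (x : E3) : E3 := !₂[-(x 1) / rho x, x 0 / rho x, 0]

/-- The vertical unit vector `e_z`. -/
noncomputable def eZ : E3 := !₂[0, 0, 1]

/-! ### Weak derivatives, Sobolev spaces -/

/-- The classical partial derivative `∂ⱼ f (x)`. -/
noncomputable def pd (j : Fin 3) (f : E3 → ℝ) (x : E3) : ℝ :=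
  fderiv ℝ f x (EuclideanSpace.single j 1)

/-- Scalar test functions, `φ ∈ C_c^∞(Ω)`. -/
structure IsTestFunction (Ω : Set E3) (φ : E3 → ℝ) : Prop where
  smooth : ContDiff ℝ ∞ φ
  compactSupport : HasCompactSupport φ
  support_subset : tsupport φ ⊆ Ω

/-- `Du` is the weak (distributional) gradient of the vector field `u` in `Ω`:
`Du x i j = ∂ⱼ uᵢ (x)`, both being locally integrable. -/
structure HasWeakGradient (Ω : Set E3) (u : E3 → E3) (Du : E3 → Matrix (Fin 3) (Fin 3) ℝ) :
    Prop where
  locallyIntegrable : ∀ i, LocallyIntegrableOn (fun x => u x i) Ω volume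
  locallyIntegrable_grad : ∀ i j, LocallyIntegrableOn (fun x => Du x i j) Ω volume
  integral_eq : ∀ i j φ, IsTestFunction Ω φ →
    ∫ x in Ω, u x i * pd j φ x = -∫ x in Ω, Du x i j * φ x

/-- `v ∈ H¹(Ω; ℝ³)` with weak gradient `Dv`. -/
structure IsH1 (Ω : Set E3) (v : E3 → E3) (Dv : E3 → Matrix (Fin 3) (Fin 3) ℝ) : Prop where
  memLp : ∀ i, MemLp (fun x => v x i) 2 (volume.restrict Ω)
  memLp_grad : ∀ i j, MemLp (fun x => Dv x i j) 2 (volume.restrict Ω)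
  hasWeakGradient : HasWeakGradient Ω v Dv

/-- `v ∈ H¹₀(Ω; ℝ³)` with weak gradient `Dv`: `v` is the limit in `H¹(Ω; ℝ³)` of a sequence of
fields in `C_c^∞(Ω; ℝ³)`. -/
structure IsH10 (Ω : Set E3) (v : E3 → E3) (Dv : E3 → Matrix (Fin 3) (Fin 3) ℝ) : Prop where
  isH1 : IsH1 Ω v Dv
  approx : ∃ φ : ℕ → E3 → E3,
    (∀ n i, IsTestFunction Ω (fun x => φ n x i)) ∧
    (∀ i, Tendsto (fun n => ∫ x in Ω, (φ n x i - v x i) ^ 2) atTop (𝓝 0)) ∧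
    (∀ i j, Tendsto (fun n => ∫ x in Ω, (pd j (fun y => φ n y i) x - Dv x i j) ^ 2)
      atTop (𝓝 0))

/-- `v ∈ V₀(Ω)` with weak gradient `Dv`: `v ∈ H¹₀(Ω; ℝ³)` and `∇ · v = 0` in `Ω`. -/
structure IsV0 (Ω : Set E3) (v : E3 → E3) (Dv : E3 → Matrix (Fin 3) (Fin 3) ℝ) : Prop where
  isH10 : IsH10 Ω v Dv
  div_eq_zero : ∀ᵐ x ∂(volume.restrict Ω), ∑ i, Dv x i i = 0

/-- The space `V₀(Ω)` of divergence-free fields in `H¹₀(Ω; ℝ³)`. -/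
def MemV0 (Ω : Set E3) (v : E3 → E3) : Prop := ∃ Dv, IsV0 Ω v Dv

/-- The divergence-free Dirichlet Poincaré constant: the infimum of
`‖∇v‖²_{L²(Ω)} / ‖v‖²_{L²(Ω)}` over the nonzero `v ∈ V₀(Ω)`. -/
noncomputable def poincareConst (Ω : Set E3) : ℝ :=
  sInf {r : ℝ | ∃ v Dv, IsV0 Ω v Dv ∧ ¬ (v =ᵐ[volume.restrict Ω] 0) ∧
    r = (∫ x in Ω, ∑ i, ∑ j, Dv x i j ^ 2) / (∫ x in Ω, ∑ i, v x i ^ 2)}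

/-! ### The Navier–Stokes problem with still outer cylinder -/

/-- `(u, p)` is a weak (distributional) solution of the steady Navier–Stokes equations
`-Δu + u·∇u + ∇p = 0`, `∇·u = 0` in the open set `Ω`, with `u ∈ H¹_loc(Ω)` and
`p ∈ L¹_loc(Ω)`. -/
def IsWeakNavierStokes (Ω : Set E3) (u : E3 → E3) (p : E3 → ℝ) : Prop :=
  ∃ Du : E3 → Matrix (Fin 3) (Fin 3) ℝ,
    HasWeakGradient Ω u Du ∧
    (∀ K ⊆ Ω, IsCompact K →
      (∀ i, MemLp (fun x => u x i) 2 (volume.restrict K)) ∧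
      (∀ i j, MemLp (fun x => Du x i j) 2 (volume.restrict K))) ∧
    LocallyIntegrableOn p Ω volume ∧
    (∀ i φ, IsTestFunction Ω φ →
      ∫ x in Ω, (∑ j, Du x i j * pd j φ x + (∑ j, u x j * Du x i j) * φ x
        - p x * pd i φ x) = 0) ∧
    (∀ᵐ x ∂(volume.restrict Ω), ∑ i, Du x i i = 0)

/-- The Dirichlet conditions `u = α e_θ` on the inner cylinder and `u = 0` on the outer cylinder, in
the sense of traces: `u` differs from a smooth extension `G` of the boundary data by a field that
lies locally (that is, after multiplication by any cut-off function `χ ∈ C_c^∞(ℝ³)`) in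
`H¹₀(Ω; ℝ³)`. -/
def HasStillOuterTrace (R₁ R₂ α : ℝ) (u : E3 → E3) : Prop :=
  ∃ G : E3 → E3, ContDiff ℝ ∞ G ∧
    (∀ x ∈ cylinder R₁, G x = α • eTheta x) ∧
    (∀ x ∈ cylinder R₂, G x = 0) ∧
    ∀ χ : E3 → ℝ, ContDiff ℝ ∞ χ → HasCompactSupport χ →
      ∃ D, IsH10 (annulus R₁ R₂) (fun x => χ x • (u x - G x)) D

/-- `(u, p)` solves the Dirichlet problem for the steady Navier–Stokes equations in the annulus,
with rotating inner cylinder and still outer cylinder. -/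
structure SolvesStillOuter (R₁ R₂ α : ℝ) (u : E3 → E3) (p : E3 → ℝ) : Prop where
  navierStokes : IsWeakNavierStokes (annulus R₁ R₂) u p
  boundary : HasStillOuterTrace R₁ R₂ α u

/-! ### The spiral Poiseuille flow -/

/-- The circular Couette profile. -/
noncomputable def couetteVelocity (R₁ R₂ r : ℝ) : ℝ :=
  R₁ / (R₂ ^ 2 - R₁ ^ 2) * (R₂ ^ 2 / r - r)

/-- The circular Couette pressure. -/
noncomputable def couettePressure (R₁ R₂ r : ℝ) : ℝ :=
  1 / 2 * (R₁ / (R₂ ^ 2 - R₁ ^ 2)) ^ 2 *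
    (r ^ 2 - R₂ ^ 4 / r ^ 2 - 4 * R₂ ^ 2 * Real.log r)

/-- The circular Poiseuille profile. -/
noncomputable def poiseuilleVelocity (R₁ R₂ r : ℝ) : ℝ :=
  1 / 4 * (r ^ 2 - R₁ ^ 2 - (R₂ ^ 2 - R₁ ^ 2) / Real.log (R₂ / R₁) * Real.log (r / R₁))

/-- The velocity of the spiral Poiseuille flow. -/
noncomputable def spiralVelocity (R₁ R₂ α β : ℝ) (x : E3) : E3 :=
  (α * couetteVelocity R₁ R₂ (rho x)) • eTheta x + (β * poiseuilleVelocity R₁ R₂ (rho x)) • eZ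

/-- The pressure of the spiral Poiseuille flow. -/
noncomputable def spiralPressure (R₁ R₂ α β : ℝ) (x : E3) : ℝ :=
  α ^ 2 * couettePressure R₁ R₂ (rho x) + β * x 2

/-- The constant `M_out(α, β)` measuring the magnitude of the spiral Poiseuille flow. -/
noncomputable def Mout (R₁ R₂ α β : ℝ) : ℝ :=
  Real.sqrt (α ^ 2 * (R₂ ^ 4 / ((R₂ ^ 2 - R₁ ^ 2) ^ 2 * R₁ ^ 2)) +
    β ^ 2 / 16 *
      ((R₂ ^ 2 - R₁ ^ 2) / (R₁ * Real.log (R₂ ^ 2 / R₁ ^ 2)) - R₁) ^ 2)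

end SpiralPoiseuille

/-!
Uniqueness of the spiral Poiseuille flow `U` in the class of perturbations `v ∈ V₀` is an energy
argument. Both `U` and `u = U + v` solve the Navier–Stokes equations, and testing the difference
with `v` leaves

  `‖∇v‖² = -∫ (v · ∇U) · v`,

since the convection term `∫ (u · ∇v) · v` vanishes for divergence free `u` and the pressure does no
work against the divergence free field `v` (`energy_identity`). The equations only admit test
functions, so `v` is replaced by test fields `φₙ → v` in `H¹`. All terms pass to the limit by
Hölder's inequality (`TendstoLp.mul`); the cubic term `∫ v ⊗ φₙ : ∇v` needs in addition `v ∈ L³` and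
`φₙ → v` in `L⁶`, which is the Gagliardo–Nirenberg–Sobolev inequality (`IsH10.exists_approx`).

Only the symmetric part of `∇U` matters on the right-hand side. In cylindrical coordinates it
consists of the shears `ρ (U_θ / ρ)'` and `U_z'` between the radial direction and the other two,
so the quadratic form is at most half of `(ρ² (U_θ / ρ)'² + U_z'²)^(1/2)` times `|v|²`. This is
largest on the inner cylinder, where it equals `Mout` (`abs_flowGrad_quadratic_le_Mout`); for the
axial part this rests on `log t ≤ (t - t⁻¹) / 2`. Hence `‖∇v‖² ≤ Mout ‖v‖²`, and `v = 0` as soon as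
a Poincaré inequality holds with a constant larger than `Mout`.

Such a constant is by definition `poincareConst`. The explicit constants come from Poincaré
inequalities for scalar test functions. The annulus lies in the slabs `|x| < R₂` and `|y| < R₂`, and
adding the two sharp slab inequalities gives `π² / (2 R₂²)` (`annulus_poincare_pi`). On a horizontal
ray, a function `g` vanishing at `R₁` and `R₂` satisfies
`g(r)² ≤ ¼ (∫ |g'|)² ≤ ¼ log(R₂ / R₁) ∫ g'² s ds`, and integrating against `r dr` gives
`8 / ((R₂² - R₁²) log(R₂ / R₁))` (`annulus_poincare_log`).

Once `v = 0`, the pressure perturbation has zero vertical derivative; being square integrable on a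
set that is invariant under vertical translations, it vanishes
(`ae_eq_zero_of_integral_mul_pd_eq_zero`).
-/

open scoped ENNReal NNReal

namespace SpiralPoiseuille

/-! ### Test functions and integration by parts -/

namespace IsTestFunction

variable {Ω : Set E3} {φ ψ : E3 → ℝ}

theorem differentiable (h : IsTestFunction Ω φ) : Differentiable ℝ φ :=
  h.smooth.differentiable (by simp)

theorem continuous (h : IsTestFunction Ω φ) : Continuous φ := h.smooth.continuous

theorem continuous_pd (h : IsTestFunction Ω φ) (j : Fin 3) : Continuous (pd j φ) :=
  (h.smooth.continuous_fderiv (by simp)).clm_apply continuous_const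

theorem tsupport_pd_subset (j : Fin 3) (φ : E3 → ℝ) : tsupport (pd j φ) ⊆ tsupport φ := by
  refine (closure_mono ?_).trans (tsupport_fderiv_subset ℝ (f := φ))
  intro x hx
  simp only [Function.mem_support, pd] at hx ⊢
  intro h
  simp [h] at hx

theorem hasCompactSupport_pd (h : IsTestFunction Ω φ) (j : Fin 3) : HasCompactSupport (pd j φ) :=
  h.compactSupport.of_isClosed_subset (isClosed_tsupport _) (tsupport_pd_subset j φ)

theorem pd (h : IsTestFunction Ω φ) (j : Fin 3) : IsTestFunction Ω (pd j φ) where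
  smooth := (h.smooth.fderiv_right (m := ∞) (by simp)).clm_apply contDiff_const
  compactSupport := h.hasCompactSupport_pd j
  support_subset := (tsupport_pd_subset j φ).trans h.support_subset

theorem mul_left (h : IsTestFunction Ω φ) (hψ : ContDiff ℝ ∞ ψ) :
    IsTestFunction Ω (fun x => ψ x * φ x) where
  smooth := hψ.mul h.smooth
  compactSupport := h.compactSupport.mul_left
  support_subset := (tsupport_mul_subset_right (f := ψ)).trans h.support_subset

theorem sq (h : IsTestFunction Ω φ) : IsTestFunction Ω (fun x => φ x ^ 2) := by
  simpa only [pow_two] using h.mul_left h.smooth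

theorem sub (h : IsTestFunction Ω φ) (h' : IsTestFunction Ω ψ) :
    IsTestFunction Ω (fun x => φ x - ψ x) where
  smooth := h.smooth.sub h'.smooth
  compactSupport := h.compactSupport.sub h'.compactSupport
  support_subset := (tsupport_sub φ ψ).trans
    (Set.union_subset h.support_subset h'.support_subset)

theorem eq_zero_of_notMem (h : IsTestFunction Ω φ) {x : E3} (hx : x ∉ Ω) : φ x = 0 :=
  image_eq_zero_of_notMem_tsupport fun hx' => hx (h.support_subset hx')

theorem memLp (h : IsTestFunction Ω φ) (p : ℝ≥0∞) : MemLp φ p volume :=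
  h.continuous.memLp_of_hasCompactSupport h.compactSupport

theorem eLpNorm_restrict (h : IsTestFunction Ω φ) (hΩ : MeasurableSet Ω) (p : ℝ≥0∞) :
    eLpNorm φ p (volume.restrict Ω) = eLpNorm φ p volume := by
  rw [← eLpNorm_indicator_eq_eLpNorm_restrict hΩ]
  congr 1
  refine Set.indicator_eq_self.2 fun x hx => ?_
  by_contra hx'
  exact hx (h.eq_zero_of_notMem hx')

theorem hasLineDerivAt (h : IsTestFunction Ω φ) (j : Fin 3) (x : E3) :
    HasLineDerivAt ℝ φ (SpiralPoiseuille.pd j φ x) x (EuclideanSpace.single j 1) :=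
  (h.differentiable x).hasFDerivAt.hasLineDerivAt _

theorem pd_sq (h : IsTestFunction Ω φ) (j : Fin 3) (x : E3) :
    SpiralPoiseuille.pd j (fun y => φ y ^ 2) x = 2 * φ x * SpiralPoiseuille.pd j φ x := by
  simp only [SpiralPoiseuille.pd]
  rw [((h.differentiable x).hasFDerivAt.pow 2).fderiv]
  simp

theorem pd_sub (h : IsTestFunction Ω φ) (h' : IsTestFunction Ω ψ) (j : Fin 3) (x : E3) :
    SpiralPoiseuille.pd j (fun y => φ y - ψ y) x =
      SpiralPoiseuille.pd j φ x - SpiralPoiseuille.pd j ψ x := by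
  simp only [SpiralPoiseuille.pd]
  rw [fderiv_fun_sub (h.differentiable x) (h'.differentiable x)]
  simp

/-- The product of a function that is locally integrable on `Ω` with a test function is
integrable. -/
theorem integrableOn_mul (h : IsTestFunction Ω φ) {f : E3 → ℝ}
    (hf : LocallyIntegrableOn f Ω volume) : IntegrableOn (fun x => f x * φ x) Ω := by
  have hK : IntegrableOn f (tsupport φ) :=
    hf.integrableOn_compact_subset h.support_subset h.compactSupport
  have h1 : IntegrableOn (fun x => f x * φ x) (tsupport φ) :=
    hK.mul_continuousOn h.continuous.continuousOn h.compactSupport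
  refine ((integrableOn_iff_integrable_of_support_subset ?_).1 h1).integrableOn
  intro x hx
  exact subset_tsupport _ fun h0 => hx (by simp [h0])

theorem setIntegral_eq (h : IsTestFunction Ω φ) (f : E3 → ℝ) :
    ∫ x in Ω, f x * φ x = ∫ x, f x * φ x := by
  refine setIntegral_eq_integral_of_forall_compl_eq_zero fun x hx => ?_
  simp [h.eq_zero_of_notMem hx]

end IsTestFunction

/-- Integration by parts against a test function, for a function `f` with continuous directional
derivative `f'` along the `j`-th axis; `f` need not be defined sensibly outside `Ω`. -/
theorem integral_mul_pd_eq_neg {Ω : Set E3} (hΩ : MeasurableSet Ω) {f f' : E3 → ℝ} {j : Fin 3}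
    (hf : ContinuousOn f Ω) (hf' : ContinuousOn f' Ω)
    (hd : ∀ x ∈ Ω, HasLineDerivAt ℝ f (f' x) x (EuclideanSpace.single j 1))
    {φ : E3 → ℝ} (hφ : IsTestFunction Ω φ) :
    ∫ x in Ω, f x * pd j φ x = -∫ x in Ω, f' x * φ x := by
  have key : ∀ {g ψ : E3 → ℝ}, ContinuousOn g Ω → IsTestFunction Ω ψ →
      Integrable (fun x => g x * ψ x) := by
    intro g ψ hg hψ
    have := hψ.integrableOn_mul (hg.locallyIntegrableOn (μ := volume) hΩ)
    refine (integrableOn_iff_integrable_of_support_subset ?_).1 this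
    intro x hx
    by_contra hx'
    exact hx (by simp [hψ.eq_zero_of_notMem hx'])
  rw [(hφ.pd j).setIntegral_eq, hφ.setIntegral_eq]
  exact integral_bilinear_hasLineDerivAt_right_eq_neg_left_of_integrable
    (B := ContinuousLinearMap.mul ℝ ℝ) (key hf' hφ) (key hf (hφ.pd j)) (key hf hφ)
    (fun x hx => hd x (hφ.support_subset hx)) (fun x _ => hφ.hasLineDerivAt j x)

/-! ### Convergence in Lebesgue spaces -/

/-- The sequence `f` in `L^p(μ)` converges to `g` in `L^p(μ)`. -/
structure TendstoLp {α : Type*} [MeasurableSpace α] (μ : Measure α) (p : ℝ≥0∞)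
    (f : ℕ → α → ℝ) (g : α → ℝ) : Prop where
  memLp : ∀ n, MemLp (f n) p μ
  memLp_lim : MemLp g p μ
  tendsto : Tendsto (fun n => eLpNorm (fun x => f n x - g x) p μ) atTop (𝓝 0)

namespace TendstoLp

variable {α : Type*} [MeasurableSpace α] {μ : Measure α} {p q r : ℝ≥0∞}
  {f f' : ℕ → α → ℝ} {g g' : α → ℝ}

theorem const (hg : MemLp g p μ) : TendstoLp μ p (fun _ => g) g :=
  ⟨fun _ => hg, hg, by simp⟩

/-- Hölder's inequality turns convergence of two factors into convergence of the product. -/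
theorem mul [p.HolderTriple q r] (hr : 1 ≤ r) (h : TendstoLp μ p f g) (h' : TendstoLp μ q f' g') :
    TendstoLp μ r (fun n x => f n x * f' n x) (fun x => g x * g' x) := by
  refine ⟨fun n => (h'.memLp n).mul' (h.memLp n), h'.memLp_lim.mul' h.memLp_lim, ?_⟩
  have hq : 1 ≤ q := hr.trans ((ENNReal.HolderTriple.le q p r))
  have hol : ∀ {u w : α → ℝ}, AEStronglyMeasurable u μ → AEStronglyMeasurable w μ →
      eLpNorm (fun x => u x * w x) r μ ≤ eLpNorm u p μ * eLpNorm w q μ := by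
    intro u w hu hw
    exact eLpNorm_smul_le_mul_eLpNorm (𝕜 := ℝ) (E := ℝ) (p := p) (q := q) (r := r) hw hu
  have bd : ∀ n, eLpNorm (fun x => f n x * f' n x - g x * g' x) r μ ≤
      eLpNorm (fun x => f n x - g x) p μ * (eLpNorm (fun x => f' n x - g' x) q μ + eLpNorm g' q μ)
        + eLpNorm g p μ * eLpNorm (fun x => f' n x - g' x) q μ := by
    intro n
    have m1 := ((h.memLp n).sub h.memLp_lim).1
    have m2 := ((h'.memLp n).sub h'.memLp_lim).1
    have e : (fun x => f n x * f' n x - g x * g' x) =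
        (fun x => (f n x - g x) * f' n x) + fun x => g x * (f' n x - g' x) := by
      ext x; simp only [Pi.add_apply]; ring
    rw [e]
    refine (eLpNorm_add_le (m1.mul (h'.memLp n).1) (h.memLp_lim.1.mul m2) hr).trans ?_
    refine add_le_add ((hol m1 (h'.memLp n).1).trans (mul_le_mul' le_rfl ?_))
      (hol h.memLp_lim.1 m2)
    have e2 : f' n = (fun x => f' n x - g' x) + g' := by ext x; simp
    conv_lhs => rw [e2]
    exact eLpNorm_add_le m2 h'.memLp_lim.1 hq
  refine tendsto_of_tendsto_of_tendsto_of_le_of_le tendsto_const_nhds ?_ (fun _ => zero_le) bd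
  have t1 := ENNReal.Tendsto.mul h.tendsto (Or.inr (by simpa using h'.memLp_lim.2.ne))
    (h'.tendsto.add_const (eLpNorm g' q μ)) (Or.inr (by simp))
  have t2 := ENNReal.Tendsto.const_mul (a := eLpNorm g p μ) h'.tendsto
    (Or.inr h.memLp_lim.2.ne)
  simpa using t1.add t2

theorem add (hp : 1 ≤ p) (h : TendstoLp μ p f g) (h' : TendstoLp μ p f' g') :
    TendstoLp μ p (fun n x => f n x + f' n x) (fun x => g x + g' x) := by
  refine ⟨fun n => (h.memLp n).add (h'.memLp n), h.memLp_lim.add h'.memLp_lim, ?_⟩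
  refine tendsto_of_tendsto_of_tendsto_of_le_of_le tendsto_const_nhds
    (by simpa using h.tendsto.add h'.tendsto) (fun _ => zero_le) fun n => ?_
  refine le_trans (le_of_eq ?_)
    (eLpNorm_add_le ((h.memLp n).sub h.memLp_lim).1 ((h'.memLp n).sub h'.memLp_lim).1 hp)
  congr 1
  ext x; simp only [Pi.add_apply]; ring

theorem sum {ι : Type*} (s : Finset ι) {f : ι → ℕ → α → ℝ} {g : ι → α → ℝ} (hp : 1 ≤ p)
    (h : ∀ i ∈ s, TendstoLp μ p (f i) (g i)) :
    TendstoLp μ p (fun n x => ∑ i ∈ s, f i n x) (fun x => ∑ i ∈ s, g i x) := by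
  classical
  induction s using Finset.induction_on with
  | empty => exact const MemLp.zero'
  | insert a s ha ih =>
    simp only [Finset.sum_insert ha]
    exact add hp (h a (by simp)) (ih fun i hi => h i (by simp [hi]))

theorem tendsto_integral (h : TendstoLp μ 1 f g) :
    Tendsto (fun n => ∫ x, f n x ∂μ) atTop (𝓝 (∫ x, g x ∂μ)) := by
  refine tendsto_integral_of_L1' g h.memLp_lim.1
    (Eventually.of_forall fun n => memLp_one_iff_integrable.1 (h.memLp n)) h.tendsto

theorem of_integral_sq (hf : ∀ n, MemLp (f n) 2 μ) (hg : MemLp g 2 μ)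
    (h : Tendsto (fun n => ∫ x, (f n x - g x) ^ 2 ∂μ) atTop (𝓝 0)) : TendstoLp μ 2 f g := by
  refine ⟨hf, hg, ?_⟩
  have e : ∀ n, eLpNorm (fun x => f n x - g x) 2 μ =
      ENNReal.ofReal ((∫ x, (f n x - g x) ^ 2 ∂μ) ^ (1 / 2 : ℝ)) := by
    intro n
    have hm : MemLp (fun x => f n x - g x) 2 μ := (hf n).sub hg
    rw [hm.eLpNorm_eq_integral_rpow_norm (by simp) (by simp)]
    simp [Real.rpow_ofNat]
  simp_rw [e]
  have := (h.rpow_const (p := 1 / 2) (Or.inr (by norm_num)))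
  simpa using ENNReal.tendsto_ofReal this

end TendstoLp

/-! ### The Sobolev embedding of `H¹₀` into `L⁶` -/

theorem norm_fderiv_le_sum_pd (φ : E3 → ℝ) (x : E3) : ‖fderiv ℝ φ x‖ ≤ ∑ j, |pd j φ x| := by
  refine ContinuousLinearMap.opNorm_le_bound _ (by positivity) fun y => ?_
  have hy : y = ∑ j, y j • EuclideanSpace.single j (1 : ℝ) := by
    ext i
    simp [Finset.sum_apply, Pi.single_apply]
  have : fderiv ℝ φ x y = ∑ j, y j * pd j φ x := by
    conv_lhs => rw [hy]
    simp [pd]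
  rw [this, Finset.sum_mul]
  refine (norm_sum_le _ _).trans (Finset.sum_le_sum fun j _ => ?_)
  rw [norm_mul, mul_comm, Real.norm_eq_abs (pd j φ x)]
  gcongr
  exact PiLp.norm_apply_le y j

/-- The Gagliardo–Nirenberg–Sobolev inequality in terms of the partial derivatives. -/
theorem exists_eLpNorm_six_le : ∃ C : ℝ≥0, ∀ (Ω : Set E3) (φ : E3 → ℝ), IsTestFunction Ω φ →
    eLpNorm φ 6 volume ≤ C * ∑ j, eLpNorm (pd j φ) 2 volume := by
  refine ⟨SNormLESNormFDerivOfEqConst ℝ (volume : Measure E3) 2, fun Ω φ h => ?_⟩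
  have h1 := eLpNorm_le_eLpNorm_fderiv_of_eq (volume : Measure E3) (p := 2) (p' := 6)
    (h.smooth.of_le (by norm_cast)) h.compactSupport
    (by norm_num) (by simp) (by simp; norm_num)
  refine h1.trans (mul_le_mul' le_rfl ?_)
  have h2 : eLpNorm (fderiv ℝ φ) 2 volume ≤ eLpNorm (fun x => ∑ j, |pd j φ x|) 2 volume :=
    eLpNorm_mono_real fun x => norm_fderiv_le_sum_pd φ x
  refine h2.trans ?_
  have e : (fun x => ∑ j, |pd j φ x|) = ∑ j, fun x => |pd j φ x| := by ext; simp
  rw [e]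
  refine (eLpNorm_sum_le (fun j _ => (h.continuous_pd j).abs.aestronglyMeasurable)
    (by norm_num)).trans (Finset.sum_le_sum fun j _ => ?_)
  exact (eLpNorm_norm (pd j φ)).le

/-- Approximation of an `H¹₀` field by test fields. By the Sobolev inequality the approximation
holds in `L⁶` as well. -/
theorem IsH10.exists_approx {Ω : Set E3} (hΩ : MeasurableSet Ω) {v : E3 → E3}
    {Dv : E3 → Matrix (Fin 3) (Fin 3) ℝ} (hv : IsH10 Ω v Dv) :
    ∃ φ : ℕ → Fin 3 → E3 → ℝ, (∀ n i, IsTestFunction Ω (φ n i)) ∧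
      (∀ i, TendstoLp (volume.restrict Ω) 2 (fun n => φ n i) (fun x => v x i)) ∧
      (∀ i j, TendstoLp (volume.restrict Ω) 2 (fun n => pd j (φ n i)) (fun x => Dv x i j)) ∧
      (∀ i, TendstoLp (volume.restrict Ω) 6 (fun n => φ n i) (fun x => v x i)) := by
  obtain ⟨φ, hφ, h0, h1⟩ := hv.approx
  have H0 : ∀ i, TendstoLp (volume.restrict Ω) 2 (fun n x => φ n x i) (fun x => v x i) :=
    fun i => .of_integral_sq (fun n => ((hφ n i).memLp 2).restrict Ω) (hv.isH1.memLp i) (h0 i)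
  have H1 : ∀ i j, TendstoLp (volume.restrict Ω) 2 (fun n => pd j fun y => φ n y i)
      (fun x => Dv x i j) :=
    fun i j => .of_integral_sq (fun n => (((hφ n i).pd j).memLp 2).restrict Ω)
      (hv.isH1.memLp_grad i j) (h1 i j)
  refine ⟨fun n i x => φ n x i, hφ, H0, H1, fun i => ?_⟩
  obtain ⟨C, hC⟩ := exists_eLpNorm_six_le
  let μ := volume.restrict Ω
  obtain ⟨ns, hns, hae⟩ := (tendstoInMeasure_of_tendsto_eLpNorm (p := 2) (by norm_num)
    (fun n => ((H0 i).memLp n).1) (H0 i).memLp_lim.1 (H0 i).tendsto).exists_seq_tendsto_ae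
  -- Fatou's lemma along the subsequence, applied to `φ n - φ m` with `n` fixed
  have key : ∀ n, eLpNorm (fun x => φ n x i - v x i) 6 μ ≤
      C * ∑ j, eLpNorm (fun x => pd j (fun y => φ n y i) x - Dv x i j) 2 μ := by
    intro n
    have b1 : eLpNorm (fun x => φ n x i - v x i) 6 μ ≤
        atTop.liminf fun m => eLpNorm (fun x => φ n x i - φ (ns m) x i) 6 μ := by
      refine Lp.eLpNorm_lim_le_liminf_eLpNorm
        (fun m => ((hφ n i).sub (hφ (ns m) i)).continuous.aestronglyMeasurable) _ ?_
      filter_upwards [hae] with x hx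
      exact hx.const_sub _
    have b2 : ∀ m, eLpNorm (fun x => φ n x i - φ (ns m) x i) 6 μ ≤
        C * ∑ j, (eLpNorm (fun x => pd j (fun y => φ n y i) x - Dv x i j) 2 μ +
          eLpNorm (fun x => pd j (fun y => φ (ns m) y i) x - Dv x i j) 2 μ) := by
      intro m
      have ht := (hφ n i).sub (hφ (ns m) i)
      rw [ht.eLpNorm_restrict hΩ]
      refine (hC Ω _ ht).trans (mul_le_mul' le_rfl (Finset.sum_le_sum fun j _ => ?_))
      rw [← (ht.pd j).eLpNorm_restrict hΩ]
      have e : pd j (fun x => φ n x i - φ (ns m) x i) =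
          (fun x => pd j (fun y => φ n y i) x - Dv x i j) -
            fun x => pd j (fun y => φ (ns m) y i) x - Dv x i j := by
        ext x
        rw [(hφ n i).pd_sub (hφ (ns m) i)]
        simp
      rw [e]
      exact eLpNorm_sub_le (((H1 i j).memLp n).sub (H1 i j).memLp_lim).1
        (((H1 i j).memLp (ns m)).sub (H1 i j).memLp_lim).1 (by norm_num)
    have b3 : Tendsto (fun m => C * ∑ j,
        (eLpNorm (fun x => pd j (fun y => φ n y i) x - Dv x i j) 2 μ +
          eLpNorm (fun x => pd j (fun y => φ (ns m) y i) x - Dv x i j) 2 μ)) atTop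
        (𝓝 (C * ∑ j, (eLpNorm (fun x => pd j (fun y => φ n y i) x - Dv x i j) 2 μ + 0))) := by
      refine ENNReal.Tendsto.const_mul ?_ (Or.inr (by simp))
      exact tendsto_finsetSum _ fun j _ =>
        ((H1 i j).tendsto.comp hns.tendsto_atTop).const_add _
    refine b1.trans ?_
    have := liminf_le_liminf (Eventually.of_forall b2) (f := atTop)
    rw [b3.liminf_eq] at this
    simpa using this
  have lim : Tendsto (fun n => eLpNorm (fun x => φ n x i - v x i) 6 μ) atTop (𝓝 0) := by
    refine tendsto_of_tendsto_of_tendsto_of_le_of_le tendsto_const_nhds ?_ (fun _ => zero_le) key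
    have : Tendsto (fun n => (C : ℝ≥0∞) * ∑ j,
        eLpNorm (fun x => pd j (fun y => φ n y i) x - Dv x i j) 2 μ) atTop
        (𝓝 (C * ∑ j : Fin 3, 0)) :=
      ENNReal.Tendsto.const_mul (tendsto_finsetSum _ fun j _ => (H1 i j).tendsto)
        (Or.inr (by simp))
    simpa using this
  have hm : ∀ n, MemLp (fun x => φ n x i) 6 μ := fun n => ((hφ n i).memLp 6).restrict Ω
  refine ⟨hm, ?_, lim⟩
  obtain ⟨n, hn⟩ := (lim.eventually (gt_mem_nhds zero_lt_one)).exists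
  have : MemLp (fun x => φ n x i - v x i) 6 μ :=
    ⟨((H0 i).memLp n |>.sub (H0 i).memLp_lim).1, hn.trans (by simp)⟩
  have h := (hm n).sub this
  convert h using 1
  ext x
  simp

/-- Interpolation between `L²` and `L⁶`, from `|t|³ ≤ t² + t⁶`. -/
theorem memLp_three_of_two_of_six {α : Type*} [MeasurableSpace α] {μ : Measure α} {f : α → ℝ}
    (h2 : MemLp f 2 μ) (h6 : MemLp f 6 μ) : MemLp f 3 μ := by
  have i2 := (integrable_norm_rpow_iff h2.1 (by simp) (by simp)).2 h2
  have i6 := (integrable_norm_rpow_iff h2.1 (by simp) (by simp)).2 h6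
  refine (integrable_norm_rpow_iff h2.1 (by simp) (by simp)).1 ?_
  simp only [ENNReal.toReal_ofNat, Real.rpow_ofNat] at i2 i6 ⊢
  refine (i2.add i6).mono' (h2.1.norm.pow 3) (Eventually.of_forall fun x => ?_)
  have h0 := norm_nonneg (f x)
  rw [Real.norm_of_nonneg (by positivity)]
  simp only [Pi.add_apply]
  nlinarith [sq_nonneg (‖f x‖ - ‖f x‖ ^ 3), sq_nonneg (‖f x‖ * (‖f x‖ - 1)),
    sq_nonneg (‖f x‖ ^ 3)]

/-! ### The annulus and the spiral Poiseuille flow -/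

/-- The squared distance `x² + y²` to the vertical axis. -/
def rhoSq (x : E3) : ℝ := x 0 ^ 2 + x 1 ^ 2

theorem continuous_rhoSq : Continuous rhoSq := by
  unfold rhoSq; fun_prop

theorem isOpen_annulus (R₁ R₂ : ℝ) : IsOpen (annulus R₁ R₂) :=
  (isOpen_lt continuous_const continuous_rhoSq).inter (isOpen_lt continuous_rhoSq continuous_const)

theorem rhoSq_pos {R₁ R₂ : ℝ} {x : E3} (hx : x ∈ annulus R₁ R₂) : 0 < rhoSq x :=
  (sq_nonneg R₁).trans_lt hx.1

/-- The Cartesian components of the flow with azimuthal velocity `k / ρ - a ρ` and vertical velocity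
`b (ρ² - R² - K log (ρ / R))`, written in terms of `ρ²` so that no square root has to be
differentiated. -/
noncomputable def flow (a b k K R : ℝ) (i : Fin 3) (x : E3) : ℝ :=
  ![-(x 1 * (k / rhoSq x - a)), x 0 * (k / rhoSq x - a),
    b * (rhoSq x - R ^ 2 - K * (1 / 2 * Real.log (rhoSq x) - Real.log R))] i

/-- The velocity gradient of `flow`: the entry `i j` is `∂ⱼ uᵢ`. -/
noncomputable def flowGrad (a b k K : ℝ) (x : E3) : Matrix (Fin 3) (Fin 3) ℝ :=
  !![2 * k * x 0 * x 1 / rhoSq x ^ 2, a - k / rhoSq x + 2 * k * x 1 ^ 2 / rhoSq x ^ 2, 0;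
    k / rhoSq x - a - 2 * k * x 0 ^ 2 / rhoSq x ^ 2, -(2 * k * x 0 * x 1 / rhoSq x ^ 2), 0;
    b * (2 * x 0 - K * x 0 / rhoSq x), b * (2 * x 1 - K * x 1 / rhoSq x), 0]

/-- The unmixed second derivatives of `flow`: the entry `i j` is `∂ⱼ∂ⱼ uᵢ`. -/
noncomputable def flowHess (b k K : ℝ) (x : E3) : Matrix (Fin 3) (Fin 3) ℝ :=
  !![2 * k * x 1 / rhoSq x ^ 2 - 8 * k * x 0 ^ 2 * x 1 / rhoSq x ^ 3,
      6 * k * x 1 / rhoSq x ^ 2 - 8 * k * x 1 ^ 3 / rhoSq x ^ 3, 0;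
    -(6 * k * x 0 / rhoSq x ^ 2 - 8 * k * x 0 ^ 3 / rhoSq x ^ 3),
      -(2 * k * x 0 / rhoSq x ^ 2 - 8 * k * x 0 * x 1 ^ 2 / rhoSq x ^ 3), 0;
    b * (2 - K / rhoSq x + 2 * K * x 0 ^ 2 / rhoSq x ^ 2),
      b * (2 - K / rhoSq x + 2 * K * x 1 ^ 2 / rhoSq x ^ 2), 0]

/-- The pressure that balances the centrifugal force of `flow` and drives its vertical part. -/
noncomputable def flowPressure (a b k : ℝ) (x : E3) : ℝ :=
  1 / 2 * (a ^ 2 * rhoSq x - k ^ 2 / rhoSq x - 2 * a * k * Real.log (rhoSq x)) + 4 * b * x 2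

/-- The gradient of `flowPressure`. -/
noncomputable def flowPressureGrad (a b k : ℝ) (x : E3) (i : Fin 3) : ℝ :=
  ![x 0 * (a - k / rhoSq x) ^ 2, x 1 * (a - k / rhoSq x) ^ 2, 4 * b] i

section derivatives

variable (j : Fin 3) (x : E3)

theorem hasDerivAt_coord (i : Fin 3) :
    HasDerivAt (fun t : ℝ => (x + t • EuclideanSpace.single j (1 : ℝ)) i)
      (if i = j then 1 else 0) 0 := by
  have : HasDerivAt (fun t : ℝ => x i + t * (if i = j then 1 else 0))
      (if i = j then 1 else 0) 0 := by
    simpa using! ((hasDerivAt_id (0 : ℝ)).mul_const (if i = j then (1 : ℝ) else 0)).const_add (x i)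
  refine this.congr_of_eventuallyEq (Eventually.of_forall fun t => ?_)
  simp

theorem hasDerivAt_rhoSq :
    HasDerivAt (fun t : ℝ => rhoSq (x + t • EuclideanSpace.single j (1 : ℝ)))
      (2 * x 0 * (if 0 = j then 1 else 0) + 2 * x 1 * (if 1 = j then 1 else 0)) 0 := by
  refine (((hasDerivAt_coord j x 0).pow 2).add ((hasDerivAt_coord j x 1).pow 2)).congr_deriv ?_
  simp

variable {x} (hx : rhoSq x ≠ 0) (a b k K R : ℝ)
include hx

theorem hasLineDerivAt_flow (i : Fin 3) :
    HasLineDerivAt ℝ (flow a b k K R i) (flowGrad a b k K x i j) x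
      (EuclideanSpace.single j 1) := by
  have h0 := hasDerivAt_coord j x 0
  have h1 := hasDerivAt_coord j x 1
  have hs := hasDerivAt_rhoSq j x
  have hx' : rhoSq (x + (0 : ℝ) • EuclideanSpace.single j (1 : ℝ)) ≠ 0 := by simpa using hx
  have hq := ((hasDerivAt_const (0 : ℝ) k).div hs hx').sub_const a
  have hl := ((((hs.log hx').const_mul (1 / 2)).sub_const (Real.log R)).const_mul K)
  have e : x 0 ^ 2 = rhoSq x - x 1 ^ 2 := by simp [rhoSq]
  fin_cases i
  · refine ((h1.mul hq).neg).congr_deriv ?_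
    fin_cases j <;> simp [flowGrad] <;> field_simp <;> ring
  · refine (h0.mul hq).congr_deriv ?_
    fin_cases j <;> simp [flowGrad] <;> field_simp <;> ring
  · refine (((hs.sub_const (R ^ 2)).sub hl).const_mul b).congr_deriv ?_
    fin_cases j <;> simp [flowGrad] <;> field_simp <;> simp

theorem hasLineDerivAt_flowGrad (i : Fin 3) :
    HasLineDerivAt ℝ (fun y => flowGrad a b k K y i j) (flowHess b k K x i j) x
      (EuclideanSpace.single j 1) := by
  have h0 := hasDerivAt_coord j x 0
  have h1 := hasDerivAt_coord j x 1
  have hs := hasDerivAt_rhoSq j x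
  have hx' : rhoSq (x + (0 : ℝ) • EuclideanSpace.single j (1 : ℝ)) ≠ 0 := by simpa using hx
  have hx2 := pow_ne_zero 2 hx'
  have hk := (hasDerivAt_const (0 : ℝ) k).div hs hx'
  have h01 := ((h0.const_mul (2 * k)).mul h1).div (hs.pow 2) hx2
  have h00 := ((h0.pow 2).const_mul (2 * k)).div (hs.pow 2) hx2
  have h11 := ((h1.pow 2).const_mul (2 * k)).div (hs.pow 2) hx2
  have hK0 := ((h0.const_mul 2).sub ((h0.const_mul K).div hs hx')).const_mul b
  have hK1 := ((h1.const_mul 2).sub ((h1.const_mul K).div hs hx')).const_mul b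
  fin_cases i <;> fin_cases j
  · refine h01.congr_deriv ?_
    simp [flowHess]; field_simp; ring
  · refine ((hk.const_sub a).add h11).congr_deriv ?_
    simp [flowHess]; field_simp; ring
  · exact hasDerivAt_const _ _
  · refine ((hk.sub_const a).sub h00).congr_deriv ?_
    simp [flowHess]; field_simp; ring
  · refine h01.neg.congr_deriv ?_
    simp [flowHess]; field_simp; ring
  · exact hasDerivAt_const _ _
  · refine hK0.congr_deriv ?_
    simp [flowHess]; field_simp; ring_nf; simp
  · refine hK1.congr_deriv ?_
    simp [flowHess]; field_simp; ring_nf; simp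
  · exact hasDerivAt_const _ _

theorem hasLineDerivAt_flowPressure :
    HasLineDerivAt ℝ (flowPressure a b k) (flowPressureGrad a b k x j) x
      (EuclideanSpace.single j 1) := by
  have h2 := hasDerivAt_coord j x 2
  have hs := hasDerivAt_rhoSq j x
  have hx' : rhoSq (x + (0 : ℝ) • EuclideanSpace.single j (1 : ℝ)) ≠ 0 := by simpa using hx
  have hk := (hasDerivAt_const (0 : ℝ) (k ^ 2)).div hs hx'
  refine (((((hs.const_mul (a ^ 2)).sub hk).sub ((hs.log hx').const_mul (2 * a * k))).const_mul
    (1 / 2)).add (h2.const_mul (4 * b))).congr_deriv ?_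
  fin_cases j <;> simp [flowPressureGrad] <;> field_simp <;> ring

/-- The momentum equation, pointwise off the axis. -/
theorem flow_momentum (i : Fin 3) :
    -∑ j, flowHess b k K x i j + ∑ j, flow a b k K R j x * flowGrad a b k K x i j
      + flowPressureGrad a b k x i = 0 := by
  have e : x 0 ^ 2 = rhoSq x - x 1 ^ 2 := by simp [rhoSq]
  fin_cases i <;> simp [Fin.sum_univ_three, flowHess, flow, flowGrad, flowPressureGrad] <;>
    field_simp <;> simp only [e] <;> ring

end derivatives

section continuity

variable (a b k K R : ℝ) {s : Set E3} (hs : ∀ x ∈ s, rhoSq x ≠ 0)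
include hs

theorem continuousOn_flow (i : Fin 3) : ContinuousOn (flow a b k K R i) s := by
  have h := continuous_rhoSq.continuousOn (s := s)
  have hq : ContinuousOn (fun x => k / rhoSq x) s := continuousOn_const.div h hs
  have hl : ContinuousOn (fun x => Real.log (rhoSq x)) s := h.log hs
  change ContinuousOn (fun x => flow a b k K R i x) s
  fin_cases i <;> simp only [flow] <;> simp <;> fun_prop

theorem continuousOn_flowGrad (i j : Fin 3) : ContinuousOn (fun x => flowGrad a b k K x i j) s := by
  have h := continuous_rhoSq.continuousOn (s := s)
  have hs2 : ∀ x ∈ s, rhoSq x ^ 2 ≠ 0 := fun x hx => pow_ne_zero 2 (hs x hx)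
  fin_cases i <;> fin_cases j <;> simp only [flowGrad] <;> simp <;>
    fun_prop (disch := assumption)

theorem continuousOn_flowHess (i j : Fin 3) : ContinuousOn (fun x => flowHess b k K x i j) s := by
  have h := continuous_rhoSq.continuousOn (s := s)
  have hs2 : ∀ x ∈ s, rhoSq x ^ 2 ≠ 0 := fun x hx => pow_ne_zero 2 (hs x hx)
  have hs3 : ∀ x ∈ s, rhoSq x ^ 3 ≠ 0 := fun x hx => pow_ne_zero 3 (hs x hx)
  fin_cases i <;> fin_cases j <;> simp only [flowHess] <;> simp <;>
    fun_prop (disch := assumption)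

theorem continuousOn_flowPressure : ContinuousOn (flowPressure a b k) s := by
  have h := continuous_rhoSq.continuousOn (s := s)
  have hl : ContinuousOn (fun x => Real.log (rhoSq x)) s := h.log hs
  unfold flowPressure
  fun_prop (disch := assumption)

theorem continuousOn_flowPressureGrad (i : Fin 3) :
    ContinuousOn (fun x => flowPressureGrad a b k x i) s := by
  have h := continuous_rhoSq.continuousOn (s := s)
  fin_cases i <;> simp only [flowPressureGrad] <;> simp <;> fun_prop (disch := assumption)

end continuity

theorem _root_.ContinuousOn.integrableOn_mul_test {Ω : Set E3} {f φ : E3 → ℝ}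
    (hΩ : MeasurableSet Ω) (hf : ContinuousOn f Ω) (hφ : IsTestFunction Ω φ) :
    IntegrableOn (fun x => f x * φ x) Ω :=
  hφ.integrableOn_mul (hf.locallyIntegrableOn hΩ)

/-- The flow solves the steady Navier–Stokes equations in the sense of distributions. -/
theorem integral_flow_momentum {Ω : Set E3} (hΩ : MeasurableSet Ω) (h0 : ∀ x ∈ Ω, rhoSq x ≠ 0)
    (a b k K R : ℝ) (i : Fin 3) {φ : E3 → ℝ} (hφ : IsTestFunction Ω φ) :
    ∫ x in Ω, (∑ j, flowGrad a b k K x i j * pd j φ x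
      + (∑ j, flow a b k K R j x * flowGrad a b k K x i j) * φ x
      - flowPressure a b k x * pd i φ x) = 0 := by
  have cG := continuousOn_flowGrad a b k K h0 i
  have cH := continuousOn_flowHess b k K h0 i
  have cU := fun j => continuousOn_flow a b k K R h0 j
  have cP := continuousOn_flowPressure a b k h0
  have cP' := continuousOn_flowPressureGrad a b k h0 i
  have cN : ContinuousOn (fun x => ∑ j, flow a b k K R j x * flowGrad a b k K x i j) Ω :=
    continuousOn_finsetSum _ fun j _ => (cU j).mul (cG j)
  have iG : ∀ j, ∫ x in Ω, flowGrad a b k K x i j * pd j φ x =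
      -∫ x in Ω, flowHess b k K x i j * φ x := fun j =>
    integral_mul_pd_eq_neg hΩ (cG j) (cH j)
      (fun x hx => hasLineDerivAt_flowGrad j (h0 x hx) a b k K i) hφ
  have iP : ∫ x in Ω, flowPressure a b k x * pd i φ x =
      -∫ x in Ω, flowPressureGrad a b k x i * φ x :=
    integral_mul_pd_eq_neg hΩ cP cP' (fun x hx => hasLineDerivAt_flowPressure i (h0 x hx) a b k) hφ
  have nG := fun j => (cG j).integrableOn_mul_test hΩ (hφ.pd j)
  have nH := fun j => (cH j).integrableOn_mul_test hΩ hφ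
  have nN := cN.integrableOn_mul_test hΩ hφ
  have nP := cP.integrableOn_mul_test hΩ (hφ.pd i)
  have nP' := cP'.integrableOn_mul_test hΩ hφ
  have sG : IntegrableOn (fun x => ∑ j, flowGrad a b k K x i j * pd j φ x) Ω :=
    integrable_finsetSum _ fun j _ => nG j
  have sH : IntegrableOn (fun x => -∑ j, flowHess b k K x i j * φ x) Ω :=
    (integrable_finsetSum _ fun j _ => nH j).neg
  have sGN : IntegrableOn (fun x => ∑ j, flowGrad a b k K x i j * pd j φ x
      + (∑ j, flow a b k K R j x * flowGrad a b k K x i j) * φ x) Ω := sG.add nN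
  have sHN : IntegrableOn (fun x => -∑ j, flowHess b k K x i j * φ x
      + (∑ j, flow a b k K R j x * flowGrad a b k K x i j) * φ x) Ω := sH.add nN
  rw [integral_sub sGN nP, integral_add sG nN, integral_finsetSum _ fun j _ => nG j, iP,
    Finset.sum_congr rfl fun j _ => iG j, Finset.sum_neg_distrib,
    ← integral_finsetSum _ fun j _ => nH j, ← integral_neg, ← integral_add sH nN, sub_neg_eq_add,
    ← integral_add sHN nP']
  refine integral_eq_zero_of_ae ((ae_restrict_mem hΩ).mono fun x hx => ?_)
  have := flow_momentum (h0 x hx) a b k K R i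
  simp only [Pi.zero_apply, ← Finset.sum_mul]
  linear_combination φ x * this

/-- A function that is continuous on the closed annulus and does not depend on the vertical
coordinate is bounded on the annulus. -/
theorem exists_bound_of_vertical_invariant {R₁ R₂ : ℝ} {f : E3 → ℝ}
    (hf : ContinuousOn f {x | R₁ ^ 2 ≤ rhoSq x ∧ rhoSq x ≤ R₂ ^ 2})
    (hinv : ∀ x, f !₂[x 0, x 1, 0] = f x) : ∃ C, ∀ x ∈ annulus R₁ R₂, |f x| ≤ C := by
  let S : Set E3 := {x | (R₁ ^ 2 ≤ rhoSq x ∧ rhoSq x ≤ R₂ ^ 2) ∧ x 2 = 0}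
  have hc : IsClosed S := by
    refine ((isClosed_le continuous_const continuous_rhoSq).inter
      (isClosed_le continuous_rhoSq continuous_const)).inter
      (isClosed_eq (by fun_prop) continuous_const)
  have hb : Bornology.IsBounded S := by
    refine (Metric.isBounded_closedBall (x := (0 : E3)) (r := |R₂|)).subset fun x hx => ?_
    rw [mem_closedBall_zero_iff, EuclideanSpace.norm_eq, ← Real.sqrt_sq_eq_abs]
    apply Real.sqrt_le_sqrt
    have h2 := hx.2
    have h1 := hx.1.2
    simp only [rhoSq] at h1
    simp [Fin.sum_univ_three, h2, h1]
  obtain ⟨C, hC⟩ := (Metric.isCompact_of_isClosed_isBounded hc hb).exists_bound_of_continuousOn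
    (hf.mono fun x hx => hx.1)
  refine ⟨C, fun x hx => ?_⟩
  rw [← hinv x]
  refine hC _ ⟨⟨?_, ?_⟩, by simp⟩
  · simpa [rhoSq] using hx.1.le
  · simpa [rhoSq] using hx.2.le

/-! ### The shear of the flow -/

/-- The quadratic form of the velocity gradient is bounded by half the magnitude of the shear,
the square of which is `k² / ρ⁴ + b² (ρ - K / (2ρ))²`. -/
theorem sq_flowGrad_quadratic_le {x : E3} (hx : 0 < rhoSq x) (a b k K : ℝ) (v : Fin 3 → ℝ) :
    (∑ i, ∑ j, v j * flowGrad a b k K x i j * v i) ^ 2 ≤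
      (k ^ 2 / rhoSq x ^ 2 + b ^ 2 * (rhoSq x - K + K ^ 2 / (4 * rhoSq x))) *
        (∑ i, v i ^ 2) ^ 2 := by
  set s := rhoSq x with hs
  -- `m / ρ` and `n / ρ` are the radial and azimuthal components of `v`
  obtain ⟨m, hm⟩ : ∃ m, m = x 0 * v 0 + x 1 * v 1 := ⟨_, rfl⟩
  obtain ⟨n, hn⟩ : ∃ n, n = x 0 * v 1 - x 1 * v 0 := ⟨_, rfl⟩
  have hmn : v 0 ^ 2 + v 1 ^ 2 = m ^ 2 / s + n ^ 2 / s := by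
    rw [← add_div, eq_div_iff hx.ne', hs, hm, hn, rhoSq]; ring
  have e1 : ∑ i, ∑ j, v j * flowGrad a b k K x i j * v i =
      2 * m * (-(k / s ^ 2) * n + b * (1 - K / (2 * s)) * v 2) := by
    simp only [Fin.sum_univ_three, flowGrad, ← hs, hm, hn]
    simp
    field_simp
    rw [show s = x 0 ^ 2 + x 1 ^ 2 from rfl]
    ring
  have e2 : k ^ 2 / s ^ 2 + b ^ 2 * (s - K + K ^ 2 / (4 * s)) =
      s * ((k / s ^ 2) ^ 2 * s + (b * (1 - K / (2 * s))) ^ 2) := by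
    field_simp; ring
  rw [e1, e2, Fin.sum_univ_three, hmn]
  generalize b * (1 - K / (2 * s)) = B
  generalize k / s ^ 2 = A
  obtain ⟨m', rfl⟩ : ∃ m', m = m' * √s := ⟨m / √s, by field_simp⟩
  obtain ⟨n', rfl⟩ : ∃ n', n = n' * √s := ⟨n / √s, by field_simp⟩
  have hq : √s ^ 2 = s := Real.sq_sqrt hx.le
  rw [mul_pow m', mul_pow n', hq, mul_div_cancel_right₀ _ hx.ne', mul_div_cancel_right₀ _ hx.ne']
  clear hm hn hmn e1 e2
  generalize √s = r at hq
  have cs : (-A * (n' * r) + B * v 2) ^ 2 ≤ (A ^ 2 * s + B ^ 2) * (n' ^ 2 + v 2 ^ 2) := by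
    rw [← hq]; nlinarith [sq_nonneg (A * r * v 2 + B * n')]
  have h4 : 4 * m' ^ 2 * (n' ^ 2 + v 2 ^ 2) ≤ (m' ^ 2 + n' ^ 2 + v 2 ^ 2) ^ 2 := by
    nlinarith [sq_nonneg (m' ^ 2 - (n' ^ 2 + v 2 ^ 2))]
  calc (2 * (m' * r) * (-A * (n' * r) + B * v 2)) ^ 2
      = s * (4 * m' ^ 2 * (-A * (n' * r) + B * v 2) ^ 2) := by
        rw [← hq]; ring_nf
    _ ≤ s * (4 * m' ^ 2 * ((A ^ 2 * s + B ^ 2) * (n' ^ 2 + v 2 ^ 2))) := by gcongr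
    _ = s * (A ^ 2 * s + B ^ 2) * (4 * m' ^ 2 * (n' ^ 2 + v 2 ^ 2)) := by ring
    _ ≤ _ := by gcongr

/-- From `log t ≤ sinh (log t) = (t - t⁻¹) / 2`. -/
theorem two_mul_le_div_log {R₁ R₂ : ℝ} (h₁ : 0 < R₁) (h₂ : R₁ < R₂) :
    2 * (R₁ * R₂) ≤ (R₂ ^ 2 - R₁ ^ 2) / Real.log (R₂ / R₁) := by
  have ht : 1 < R₂ / R₁ := (one_lt_div h₁).2 h₂
  have hl := Real.log_pos ht
  have h := Real.self_le_sinh_iff.2 hl.le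
  rw [Real.sinh_log (by positivity)] at h
  rw [le_div_iff₀ hl]
  have hR₂ : 0 < R₂ := h₁.trans h₂
  calc 2 * (R₁ * R₂) * Real.log (R₂ / R₁)
      ≤ 2 * (R₁ * R₂) * ((R₂ / R₁ - (R₂ / R₁)⁻¹) / 2) := by gcongr
    _ = _ := by field_simp

/-- The shear of the spiral Poiseuille flow is largest at the inner cylinder. -/
theorem shear_sq_le {R₁ R₂ s : ℝ} (h₁ : 0 < R₁) (h₂ : R₁ < R₂) (hs₁ : R₁ ^ 2 ≤ s)
    (hs₂ : s ≤ R₂ ^ 2) (b k : ℝ) {K : ℝ} (hK : 2 * (R₁ * R₂) ≤ K) :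
    k ^ 2 / s ^ 2 + b ^ 2 * (s - K + K ^ 2 / (4 * s)) ≤
      k ^ 2 / R₁ ^ 4 + b ^ 2 * (R₁ - K / (2 * R₁)) ^ 2 := by
  have hR₂ : 0 < R₂ := h₁.trans h₂
  have hs : 0 < s := lt_of_lt_of_le (by positivity) hs₁
  have i1 : R₁ ^ 4 ≤ s ^ 2 := by nlinarith [sq_nonneg R₁]
  have i2 : 4 * (R₁ ^ 2 * s) ≤ K ^ 2 := by
    calc 4 * (R₁ ^ 2 * s) ≤ 4 * (R₁ ^ 2 * R₂ ^ 2) := by gcongr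
      _ = (2 * (R₁ * R₂)) ^ 2 := by ring
      _ ≤ K ^ 2 := by gcongr
  refine add_le_add (by gcongr) (mul_le_mul_of_nonneg_left ?_ (sq_nonneg b))
  have e : (R₁ - K / (2 * R₁)) ^ 2 - (s - K + K ^ 2 / (4 * s)) =
      (s - R₁ ^ 2) * (K ^ 2 - 4 * (R₁ ^ 2 * s)) / (4 * R₁ ^ 2 * s) := by
    field_simp; ring
  have : 0 ≤ (s - R₁ ^ 2) * (K ^ 2 - 4 * (R₁ ^ 2 * s)) / (4 * R₁ ^ 2 * s) :=
    div_nonneg (mul_nonneg (by linarith) (by linarith)) (by positivity)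
  linarith

section spiral

variable {R₁ R₂ : ℝ} (h₁ : 0 < R₁) (h₂ : R₁ < R₂) (α β : ℝ)

/-- The coefficient `a` of the rigid rotation `-a ρ e_θ` in the spiral Poiseuille flow. -/
noncomputable def spiralRotation (R₁ R₂ α : ℝ) : ℝ := α * (R₁ / (R₂ ^ 2 - R₁ ^ 2))

/-- Twice the logarithmic mean of `R₁²` and `R₂²`; the coefficient of `log (ρ / R₁)` in the profile
of the axial velocity. -/
noncomputable def twoLogMean (R₁ R₂ : ℝ) : ℝ := (R₂ ^ 2 - R₁ ^ 2) / Real.log (R₂ / R₁)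

theorem log_rho (x : E3) : Real.log (rho x) = 1 / 2 * Real.log (rhoSq x) := by
  rw [rho, ← rhoSq, Real.log_sqrt (by unfold rhoSq; positivity)]; ring

include h₁ in
theorem spiralVelocity_eq_flow {x : E3} (hx : 0 < rhoSq x) (i : Fin 3) :
    spiralVelocity R₁ R₂ α β x i = flow (spiralRotation R₁ R₂ α) (β / 4)
      (spiralRotation R₁ R₂ α * R₂ ^ 2) (twoLogMean R₁ R₂) R₁ i x := by
  have hr : rho x ^ 2 = rhoSq x := Real.sq_sqrt hx.le
  have hr0 : 0 < rho x := Real.sqrt_pos.2 hx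
  have hl : Real.log (rho x / R₁) = 1 / 2 * Real.log (rhoSq x) - Real.log R₁ := by
    rw [Real.log_div hr0.ne' h₁.ne', log_rho]
  have e : R₁ / (R₂ ^ 2 - R₁ ^ 2) * (R₂ ^ 2 / rho x - rho x) / rho x =
      R₁ / (R₂ ^ 2 - R₁ ^ 2) * (R₂ ^ 2 / rhoSq x - 1) := by
    rw [← hr]; field_simp
  fin_cases i
  · simp [spiralVelocity, flow, eTheta, eZ, couetteVelocity, spiralRotation]
    linear_combination -(α * x 1) * e
  · simp [spiralVelocity, flow, eTheta, eZ, couetteVelocity, spiralRotation]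
    linear_combination (α * x 0) * e
  · simp only [spiralVelocity, flow, eTheta, eZ, poiseuilleVelocity, hl, hr, twoLogMean]
    simp
    ring

theorem spiralPressure_eq_flowPressure {x : E3} (hx : 0 < rhoSq x) :
    spiralPressure R₁ R₂ α β x = flowPressure (spiralRotation R₁ R₂ α) (β / 4)
      (spiralRotation R₁ R₂ α * R₂ ^ 2) x := by
  have hr : rho x ^ 2 = rhoSq x := Real.sq_sqrt hx.le
  simp only [spiralPressure, couettePressure, flowPressure, log_rho, hr, spiralRotation]
  ring

include h₁ h₂ in
/-- The spiral Poiseuille flow has shear at most `Mout`. -/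
theorem abs_flowGrad_quadratic_le_Mout {x : E3} (hx : x ∈ annulus R₁ R₂) (v : Fin 3 → ℝ) :
    |∑ i, ∑ j, v j * flowGrad (spiralRotation R₁ R₂ α) (β / 4)
      (spiralRotation R₁ R₂ α * R₂ ^ 2) (twoLogMean R₁ R₂) x i j * v i| ≤
      Mout R₁ R₂ α β * ∑ i, v i ^ 2 := by
  refine abs_le_of_sq_le_sq ?_ (mul_nonneg (Real.sqrt_nonneg _) (by positivity))
  refine (sq_flowGrad_quadratic_le (rhoSq_pos hx) _ _ _ _ v).trans ?_
  rw [mul_pow (Mout R₁ R₂ α β), Mout, Real.sq_sqrt (by positivity)]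
  refine mul_le_mul_of_nonneg_right ?_ (sq_nonneg _)
  refine (shear_sq_le h₁ h₂ hx.1.le hx.2.le _ _ (two_mul_le_div_log h₁ h₂)).trans (le_of_eq ?_)
  have hl : Real.log (R₂ ^ 2 / R₁ ^ 2) = 2 * Real.log (R₂ / R₁) := by
    rw [← div_pow, Real.log_pow]; norm_num
  have hl0 : Real.log (R₂ / R₁) ≠ 0 := (Real.log_pos ((one_lt_div h₁).2 h₂)).ne'
  have hd : R₂ ^ 2 - R₁ ^ 2 ≠ 0 := by nlinarith
  rw [hl, spiralRotation]
  field_simp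
  ring

end spiral

/-! ### The energy identity for a perturbation of a bounded flow -/

/-- A classical steady flow on `Ω`: the velocity `U` and its gradient `DU` are continuous and
bounded, the pressure `P` is continuous, and the momentum equation holds in the sense of
distributions. -/
structure IsBoundedFlow (Ω : Set E3) (U : Fin 3 → E3 → ℝ) (DU : E3 → Matrix (Fin 3) (Fin 3) ℝ)
    (P : E3 → ℝ) : Prop where
  continuousOn : ∀ i, ContinuousOn (U i) Ω
  continuousOn_grad : ∀ i j, ContinuousOn (fun x => DU x i j) Ω
  continuousOn_pressure : ContinuousOn P Ω
  bounded : ∀ i, ∃ C, ∀ x ∈ Ω, |U i x| ≤ C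
  bounded_grad : ∀ i j, ∃ C, ∀ x ∈ Ω, |DU x i j| ≤ C
  hasLineDerivAt : ∀ i j, ∀ x ∈ Ω, HasLineDerivAt ℝ (U i) (DU x i j) x (EuclideanSpace.single j 1)
  momentum : ∀ i φ, IsTestFunction Ω φ → ∫ x in Ω, (∑ j, DU x i j * pd j φ x
    + (∑ j, U j x * DU x i j) * φ x - P x * pd i φ x) = 0

section perturbation

variable {Ω : Set E3} {U : Fin 3 → E3 → ℝ} {DU : E3 → Matrix (Fin 3) (Fin 3) ℝ} {P : E3 → ℝ}
  {v : E3 → E3} {Dv : E3 → Matrix (Fin 3) (Fin 3) ℝ} {q : E3 → ℝ}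
  {u : E3 → E3} {Du : E3 → Matrix (Fin 3) (Fin 3) ℝ} {p : E3 → ℝ}

theorem memLp_top_of_continuousOn {f : E3 → ℝ} (hΩ : MeasurableSet Ω) (hf : ContinuousOn f Ω)
    (hb : ∃ C, ∀ x ∈ Ω, |f x| ≤ C) : MemLp f ∞ (volume.restrict Ω) := by
  obtain ⟨C, hC⟩ := hb
  exact memLp_top_of_bound (hf.aestronglyMeasurable hΩ) C ((ae_restrict_mem hΩ).mono hC)

/-- By uniqueness of weak gradients, the gradient in the weak formulation for `u = U + v` splits. -/
theorem weakGradient_ae_eq_add (hΩ : IsOpen Ω) (hU : IsBoundedFlow Ω U DU P)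
    (hv : HasWeakGradient Ω v Dv) (hu : HasWeakGradient Ω u Du)
    (huv : ∀ x ∈ Ω, ∀ i, u x i = U i x + v x i) :
    ∀ᵐ x ∂(volume.restrict Ω), ∀ i j, Du x i j = DU x i j + Dv x i j := by
  rw [ae_all_iff]; intro i
  rw [ae_all_iff]; intro j
  have hm := hΩ.measurableSet
  have lU := (hU.continuousOn i).locallyIntegrableOn (μ := volume) hm
  have lDU := (hU.continuousOn_grad i j).locallyIntegrableOn (μ := volume) hm
  have hl : LocallyIntegrableOn (fun x => Du x i j - (DU x i j + Dv x i j)) Ω volume :=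
    (hu.locallyIntegrable_grad i j).sub (lDU.add (hv.locallyIntegrable_grad i j))
  have key := hΩ.ae_eq_zero_of_integral_contDiff_smul_eq_zero hl ?_
  · refine (ae_restrict_iff' hm).2 (key.mono fun x hx hxΩ => ?_)
    linarith [hx hxΩ]
  · intro φ h1 h2 h3
    have hφ : IsTestFunction Ω φ := ⟨h1, h2, h3⟩
    have e1 := hu.integral_eq i j φ hφ
    have e2 := hv.integral_eq i j φ hφ
    have e3 := integral_mul_pd_eq_neg hm (hU.continuousOn i) (hU.continuousOn_grad i j)
      (hU.hasLineDerivAt i j) hφ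
    have e4 : ∫ x in Ω, u x i * pd j φ x =
        (∫ x in Ω, U i x * pd j φ x) + ∫ x in Ω, v x i * pd j φ x := by
      rw [← integral_add ((hφ.pd j).integrableOn_mul lU)
        ((hφ.pd j).integrableOn_mul (hv.locallyIntegrable i))]
      refine setIntegral_congr_fun hm fun x hx => ?_
      simp only [huv x hx]; ring
    have e5 : ∫ x, φ x • (Du x i j - (DU x i j + Dv x i j)) =
        (∫ x in Ω, Du x i j * φ x) - ((∫ x in Ω, DU x i j * φ x) + ∫ x in Ω, Dv x i j * φ x) := by
      have iDU := hφ.integrableOn_mul lDU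
      have iDv := hφ.integrableOn_mul (hv.locallyIntegrable_grad i j)
      have iS : IntegrableOn (fun x => DU x i j * φ x + Dv x i j * φ x) Ω := iDU.add iDv
      rw [← integral_add iDU iDv, ← integral_sub
        (hφ.integrableOn_mul (hu.locallyIntegrable_grad i j)) iS]
      have := hφ.setIntegral_eq (fun x => Du x i j - (DU x i j + Dv x i j))
      simp only [smul_eq_mul, mul_comm (φ _)]
      rw [← this]
      congr 1 with x
      ring
    rw [e5]; linarith

/-- Difference of the momentum equations of the perturbed and of the unperturbed flow, tested
with a single component. -/
theorem integral_perturbation_eq_zero (hΩ : IsOpen Ω) (hU : IsBoundedFlow Ω U DU P)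
    (hD : ∀ᵐ x ∂(volume.restrict Ω), ∀ i j, Du x i j = DU x i j + Dv x i j)
    (huv : ∀ x ∈ Ω, ∀ i, u x i = U i x + v x i) (hpq : ∀ x ∈ Ω, p x = P x + q x)
    {i : Fin 3} {φ : E3 → ℝ} (hφ : IsTestFunction Ω φ)
    (hNS : ∫ x in Ω, (∑ j, Du x i j * pd j φ x + (∑ j, u x j * Du x i j) * φ x
      - p x * pd i φ x) = 0)
    (hint : IntegrableOn (fun x => ∑ j, Dv x i j * pd j φ x
      + ∑ j, ((U j x + v x j) * φ x) * Dv x i j + ∑ j, (v x j * DU x i j) * φ x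
      - q x * pd i φ x) Ω) :
    ∫ x in Ω, (∑ j, Dv x i j * pd j φ x + ∑ j, ((U j x + v x j) * φ x) * Dv x i j
      + ∑ j, (v x j * DU x i j) * φ x - q x * pd i φ x) = 0 := by
  have hm := hΩ.measurableSet
  have iU : IntegrableOn (fun x => ∑ j, DU x i j * pd j φ x
      + (∑ j, U j x * DU x i j) * φ x - P x * pd i φ x) Ω :=
    ((integrable_finsetSum _ fun j _ =>
      (hU.continuousOn_grad i j).integrableOn_mul_test hm (hφ.pd j)).add
    ((continuousOn_finsetSum _ fun j _ => (hU.continuousOn j).mul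
      (hU.continuousOn_grad i j)).integrableOn_mul_test hm hφ)).sub
    (hU.continuousOn_pressure.integrableOn_mul_test hm (hφ.pd i))
  have e := integral_add iU hint
  rw [hU.momentum i φ hφ, zero_add] at e
  rw [← e, ← hNS]
  refine integral_congr_ae ?_
  filter_upwards [hD, ae_restrict_mem hm] with x hx hxΩ
  simp only [hx, huv x hxΩ, hpq x hxΩ, Fin.sum_univ_three]
  ring

instance : ENNReal.HolderTriple 3 6 2 where
  inv_add_inv_eq_inv := by
    rw [← ENNReal.toReal_eq_toReal_iff' (by simp) (by simp), ENNReal.toReal_add (by simp) (by simp)]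
    norm_num

/-- Transport by the divergence free field `u = U + v` does no work on a test function `φ`, because
`(u · ∇φ) φ = ½ u · ∇(φ²)` and `φ²` is an admissible test function. -/
theorem integral_convection_eq_zero (hm : MeasurableSet Ω) (hu : HasWeakGradient Ω u Du)
    (hdiv : ∀ᵐ x ∂(volume.restrict Ω), ∑ i, Du x i i = 0)
    (huv : ∀ x ∈ Ω, ∀ i, u x i = U i x + v x i) {φ : E3 → ℝ} (hφ : IsTestFunction Ω φ)
    (hint : ∀ j, IntegrableOn (fun x => ((U j x + v x j) * φ x) * pd j φ x) Ω) :
    ∫ x in Ω, ∑ j, ((U j x + v x j) * φ x) * pd j φ x = 0 := by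
  have e : ∀ j, ∫ x in Ω, ((U j x + v x j) * φ x) * pd j φ x =
      -(1 / 2) * ∫ x in Ω, Du x j j * φ x ^ 2 := by
    intro j
    have := hu.integral_eq j j _ hφ.sq
    rw [neg_mul, ← mul_neg, ← this, ← integral_const_mul]
    refine setIntegral_congr_fun hm fun x hx => ?_
    simp only [hφ.pd_sq, huv x hx]
    ring
  rw [integral_finsetSum _ fun j _ => hint j]
  simp_rw [e]
  rw [← Finset.mul_sum, ← integral_finsetSum _ fun j _ =>
    hφ.sq.integrableOn_mul (hu.locallyIntegrable_grad j j)]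
  rw [integral_eq_zero_of_ae, mul_zero]
  filter_upwards [hdiv] with x hx
  rw [← Finset.sum_mul, hx, zero_mul, Pi.zero_apply]

/-- The energy identity `‖∇v‖² = -∫ (v · ∇U) · v`. -/
theorem energy_identity (hΩ : IsOpen Ω) (hU : IsBoundedFlow Ω U DU P) (hv : IsV0 Ω v Dv)
    (hq : MemLp q 2 (volume.restrict Ω)) (hu : HasWeakGradient Ω u Du)
    (hNS : ∀ i φ, IsTestFunction Ω φ → ∫ x in Ω, (∑ j, Du x i j * pd j φ x
      + (∑ j, u x j * Du x i j) * φ x - p x * pd i φ x) = 0)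
    (hdiv : ∀ᵐ x ∂(volume.restrict Ω), ∑ i, Du x i i = 0)
    (huv : ∀ x ∈ Ω, ∀ i, u x i = U i x + v x i) (hpq : ∀ x ∈ Ω, p x = P x + q x) :
    IntegrableOn (fun x => ∑ i, ∑ j, v x j * DU x i j * v x i) Ω ∧
    ∫ x in Ω, ∑ i, ∑ j, Dv x i j ^ 2 = -∫ x in Ω, ∑ i, ∑ j, v x j * DU x i j * v x i := by
  have hm := hΩ.measurableSet
  have hD := weakGradient_ae_eq_add hΩ hU hv.isH10.isH1.hasWeakGradient hu huv
  obtain ⟨φ, hφ, H0, H1, H6⟩ := hv.isH10.exists_approx hm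
  have h3 := fun i => memLp_three_of_two_of_six (H0 i).memLp_lim (H6 i).memLp_lim
  have bU := fun i => memLp_top_of_continuousOn hm (hU.continuousOn i) (hU.bounded i)
  have bDU := fun i j => memLp_top_of_continuousOn hm (hU.continuousOn_grad i j)
    (hU.bounded_grad i j)
  have mG := hv.isH10.isH1.memLp_grad
  -- `u φₙ → u v` in `L²`: the bounded part of `u` is paired with `L²`, the other with `L⁶`
  have T : ∀ j i, TendstoLp (volume.restrict Ω) 2 (fun n x => (U j x + v x j) * φ n i x)
      (fun x => (U j x + v x j) * v x i) := by
    intro j i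
    simp only [add_mul]
    exact ((TendstoLp.const (bU j)).mul (by norm_num) (H0 i)).add (by norm_num)
      ((TendstoLp.const (h3 j)).mul (by norm_num) (H6 i))
  have T1 : ∀ i j, TendstoLp (volume.restrict Ω) 1 (fun n x => Dv x i j * pd j (φ n i) x)
      (fun x => Dv x i j * Dv x i j) :=
    fun i j => (TendstoLp.const (mG i j)).mul le_rfl (H1 i j)
  have T2 : ∀ i j, TendstoLp (volume.restrict Ω) 1
      (fun n x => ((U j x + v x j) * φ n i x) * Dv x i j)
      (fun x => ((U j x + v x j) * v x i) * Dv x i j) :=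
    fun i j => (T j i).mul le_rfl (TendstoLp.const (mG i j))
  have T3 : ∀ i j, TendstoLp (volume.restrict Ω) 1 (fun n x => (v x j * DU x i j) * φ n i x)
      (fun x => (v x j * DU x i j) * v x i) :=
    fun i j => (TendstoLp.const ((bDU i j).mul' (r := 2) (H0 j).memLp_lim)).mul le_rfl (H0 i)
  have T4 : ∀ i, TendstoLp (volume.restrict Ω) 1 (fun n x => -q x * pd i (φ n i) x)
      (fun x => -q x * Dv x i i) :=
    fun i => (TendstoLp.const hq.neg).mul le_rfl (H1 i i)
  have T5 : ∀ i j, TendstoLp (volume.restrict Ω) 1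
      (fun n x => ((U j x + v x j) * φ n i x) * pd j (φ n i) x)
      (fun x => ((U j x + v x j) * v x i) * Dv x i j) :=
    fun i j => (T j i).mul le_rfl (H1 i j)
  have I1 := fun i j => memLp_one_iff_integrable.1 (T1 i j).memLp_lim
  have I2 := fun i j => memLp_one_iff_integrable.1 (T2 i j).memLp_lim
  have I3 := fun i j => memLp_one_iff_integrable.1 (T3 i j).memLp_lim
  have I4 := fun i => memLp_one_iff_integrable.1 (T4 i).memLp_lim
  have conv : ∀ i, ∫ x in Ω, ∑ j, ((U j x + v x j) * v x i) * Dv x i j = 0 := by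
    intro i
    have lim := (TendstoLp.sum Finset.univ le_rfl fun j _ => T5 i j).tendsto_integral
    refine tendsto_nhds_unique lim (tendsto_const_nhds.congr fun n => ?_)
    exact (integral_convection_eq_zero hm hu hdiv huv (hφ n i)
      fun j => memLp_one_iff_integrable.1 ((T5 i j).memLp n)).symm
  have mom : ∀ i, ∫ x in Ω, (∑ j, Dv x i j * Dv x i j + ∑ j, ((U j x + v x j) * v x i) * Dv x i j
      + ∑ j, (v x j * DU x i j) * v x i + -q x * Dv x i i) = 0 := by
    intro i
    have TS := (((TendstoLp.sum Finset.univ le_rfl fun j _ => T1 i j).add le_rfl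
      (TendstoLp.sum Finset.univ le_rfl fun j _ => T2 i j)).add le_rfl
      (TendstoLp.sum Finset.univ le_rfl fun j _ => T3 i j)).add le_rfl (T4 i)
    refine tendsto_nhds_unique TS.tendsto_integral (tendsto_const_nhds.congr fun n => ?_)
    have hi := memLp_one_iff_integrable.1 (TS.memLp n)
    simp only [neg_mul, ← sub_eq_add_neg] at hi ⊢
    exact (integral_perturbation_eq_zero hΩ hU hD huv hpq (hφ n i) (hNS i _ (hφ n i)) hi).symm
  have S1 := fun i => integrable_finsetSum Finset.univ fun j _ => I1 i j
  have S2 := fun i => integrable_finsetSum Finset.univ fun j _ => I2 i j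
  have S3 := fun i => integrable_finsetSum Finset.univ fun j _ => I3 i j
  have mom' : ∀ i, (∫ x in Ω, ∑ j, Dv x i j * Dv x i j)
      + (∫ x in Ω, ∑ j, (v x j * DU x i j) * v x i)
      + ∫ x in Ω, -q x * Dv x i i = 0 := by
    intro i
    have := mom i
    have S12 : Integrable (fun x => ∑ j, Dv x i j * Dv x i j
      + ∑ j, ((U j x + v x j) * v x i) * Dv x i j) (volume.restrict Ω) := (S1 i).add (S2 i)
    have S123 : Integrable (fun x => ∑ j, Dv x i j * Dv x i j
      + ∑ j, ((U j x + v x j) * v x i) * Dv x i j + ∑ j, (v x j * DU x i j) * v x i)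
      (volume.restrict Ω) := S12.add (S3 i)
    rw [integral_add S123 (I4 i), integral_add S12 (S3 i), integral_add (S1 i) (S2 i), conv i]
      at this
    linarith
  have press : ∑ i, ∫ x in Ω, -q x * Dv x i i = 0 := by
    rw [← integral_finsetSum _ fun i _ => I4 i]
    refine integral_eq_zero_of_ae ?_
    filter_upwards [hv.div_eq_zero] with x hx
    rw [← Finset.mul_sum, hx, mul_zero, Pi.zero_apply]
  refine ⟨integrable_finsetSum _ fun i _ => S3 i, ?_⟩
  simp only [pow_two]
  rw [integral_finsetSum _ fun i _ => S1 i, integral_finsetSum _ fun i _ => S3 i]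
  have := Finset.sum_eq_zero fun i (_ : i ∈ Finset.univ) => mom' i
  rw [Finset.sum_add_distrib, Finset.sum_add_distrib, press] at this
  linarith

end perturbation

/-! ### The pressure -/

/-- The translate of a test function along the vertical axis. -/
theorem IsTestFunction.comp_sub_smul {Ω : Set E3} {φ : E3 → ℝ} (h : IsTestFunction Ω φ) {e : E3}
    (hΩ : ∀ x ∈ Ω, ∀ s : ℝ, x + s • e ∈ Ω) (s : ℝ) :
    IsTestFunction Ω (fun x => φ (x - s • e)) where
  smooth := h.smooth.comp (contDiff_id.sub contDiff_const)
  compactSupport := h.compactSupport.comp_homeomorph (Homeomorph.subRight (s • e))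
  support_subset := by
    intro x hx
    have : x - s • e ∈ tsupport φ :=
      tsupport_comp_subset_preimage (f := fun y : E3 => y - s • e) φ (by fun_prop) hx
    simpa using hΩ _ (h.support_subset this) s

theorem pd_comp_sub (φ : E3 → ℝ) (j : Fin 3) (y x : E3) :
    pd j (fun x => φ (x - y)) x = pd j φ (x - y) := by
  simp only [pd, fderiv_comp_sub]

/-- A square integrable function whose vertical derivative vanishes is zero, on a set that is
invariant under vertical translations: its integral against a test function does not change when
the test function is moved to infinity, where the `L²` norm of the function is small. -/
theorem ae_eq_zero_of_integral_mul_pd_eq_zero {Ω : Set E3} (hΩ : IsOpen Ω) {j : Fin 3}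
    (hinv : ∀ x ∈ Ω, ∀ s : ℝ, x + s • EuclideanSpace.single j (1 : ℝ) ∈ Ω) {q : E3 → ℝ}
    (hq : MemLp q 2 (volume.restrict Ω))
    (h : ∀ φ, IsTestFunction Ω φ → ∫ x in Ω, q x * pd j φ x = 0) :
    q =ᵐ[volume.restrict Ω] 0 := by
  have hm := hΩ.measurableSet
  set e : E3 := EuclideanSpace.single j (1 : ℝ) with he
  have hl : LocallyIntegrableOn q Ω volume := by
    rw [locallyIntegrableOn_iff hΩ.isLocallyClosed]
    intro K hK hKc
    have : IsFiniteMeasure (volume.restrict K) := ⟨by simpa using hKc.measure_lt_top⟩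
    have h2 : MemLp q 2 (volume.restrict K) := hq.mono_measure (Measure.restrict_mono hK le_rfl)
    exact memLp_one_iff_integrable.1 (h2.mono_exponent (by norm_num))
  have key := hΩ.ae_eq_zero_of_integral_contDiff_smul_eq_zero hl ?_
  · exact (ae_restrict_iff' hm).2 key
  intro φ c1 c2 c3
  have hφ : IsTestFunction Ω φ := ⟨c1, c2, c3⟩
  have ht := fun s => hφ.comp_sub_smul hinv s
  let g : ℝ → ℝ := fun s => ∫ x in Ω, q x * φ (x - s • e)
  have hg : ∀ s, HasDerivAt g 0 s := by
    intro s
    obtain ⟨C, hC⟩ := (hφ.continuous_pd j).bounded_above_of_compact_support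
      (hφ.hasCompactSupport_pd j)
    let K : Set E3 := (fun p : ℝ × E3 => p.2 + p.1 • e) '' (Metric.closedBall s 1 ×ˢ tsupport φ)
    have hKc : IsCompact K :=
      ((isCompact_closedBall s 1).prod hφ.compactSupport).image (by fun_prop)
    have hKΩ : K ⊆ Ω := by
      rintro _ ⟨p, hp, rfl⟩
      exact hinv _ (hφ.support_subset hp.2) _
    have hd := hasDerivAt_integral_of_dominated_loc_of_deriv_le (μ := volume.restrict Ω)
      (F := fun s x => q x * φ (x - s • e)) (F' := fun s x => q x * -pd j φ (x - s • e))
      (x₀ := s) (s := Metric.ball s 1) (bound := K.indicator fun x => |q x| * C)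
      (Metric.ball_mem_nhds s one_pos)
      (Eventually.of_forall fun t => hq.1.mul (ht t).continuous.aestronglyMeasurable)
      ((ht s).integrableOn_mul hl)
      (hq.1.mul ((hφ.continuous_pd j).comp (by fun_prop)).neg.aestronglyMeasurable)
      (Eventually.of_forall fun x t htb => ?_) ?_ (Eventually.of_forall fun x t htb => ?_)
    · refine hd.2.congr_deriv ?_
      have := h _ (ht s)
      simp only [pd_comp_sub] at this
      simp only [mul_neg, integral_neg, this, neg_zero]
    · by_cases hx : x ∈ K
      · rw [Set.indicator_of_mem hx, norm_mul, norm_neg, Real.norm_eq_abs (q x)]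
        gcongr
        exact hC _
      · have : pd j φ (x - t • e) = 0 := by
          refine image_eq_zero_of_notMem_tsupport fun hx' => hx ?_
          exact ⟨(t, x - t • e), ⟨Metric.ball_subset_closedBall htb,
            IsTestFunction.tsupport_pd_subset j φ hx'⟩, by simp⟩
        simp [this, Set.indicator_of_notMem hx]
    · refine IntegrableOn.integrable_indicator ?_ hKc.measurableSet
      refine Integrable.mul_const (Integrable.abs ?_) _
      rw [Measure.restrict_restrict hKc.measurableSet, Set.inter_eq_left.2 hKΩ]
      exact hl.integrableOn_compact_subset hKΩ hKc
    · have h1 : HasDerivAt (fun t : ℝ => x - t • e) (-e) t := by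
        simpa using ((hasDerivAt_id t).smul_const e).const_sub x
      have h2 := (hφ.differentiable (x - t • e)).hasFDerivAt.comp_hasDerivAt t h1
      refine (h2.const_mul (q x)).congr_deriv ?_
      simp [pd, he]
  have hgc : ∀ s, g s = g 0 := fun s =>
    is_const_of_deriv_eq_zero (fun s => (hg s).differentiableAt) (fun s => (hg s).deriv) s 0
  set c := g 0 with hc
  have hgoal : ∫ x, φ x • q x = c := by
    rw [hc]
    simp only [g, zero_smul, sub_zero]
    rw [hφ.setIntegral_eq]
    simp [mul_comm]
  rw [hgoal]
  let S : ℕ → Set E3 := fun n => {x | φ (x - (n : ℝ) • e) ≠ 0}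
  have hS : ∀ n, MeasurableSet (S n) := fun n =>
    (isOpen_ne_fun (ht n).continuous continuous_const).measurableSet
  have hA : Tendsto (fun n => ∫ x in Ω, (S n).indicator (fun x => q x ^ 2) x) atTop (𝓝 0) := by
    have := tendsto_integral_of_dominated_convergence (μ := volume.restrict Ω)
      (F := fun n => (S n).indicator (fun x => q x ^ 2)) (f := fun _ => 0) (fun x => q x ^ 2)
      (fun n => ((hq.1.pow 2).indicator (hS n))) hq.integrable_sq
      (fun n => Eventually.of_forall fun x => ?_) (Eventually.of_forall fun x => ?_)
    · simpa using this
    · by_cases hx : x ∈ S n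
      · simp [Set.indicator_of_mem hx]
      · simp [Set.indicator_of_notMem hx, sq_nonneg]
    · obtain ⟨r, hr⟩ := hφ.compactSupport.isCompact.isBounded.exists_norm_le
      refine tendsto_const_nhds.congr' ?_
      filter_upwards [eventually_gt_atTop ⌈‖x‖ + r⌉₊] with n hn
      rw [Set.indicator_of_notMem]
      intro hx
      have h1 := hr _ (subset_tsupport _ hx)
      have h2 : (n : ℝ) = ‖(n : ℝ) • e‖ := by simp [norm_smul, he]
      have h3 : ‖(n : ℝ) • e‖ ≤ ‖x‖ + ‖x - (n : ℝ) • e‖ := by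
        have := norm_sub_le x (x - (n : ℝ) • e)
        simpa using this
      have h4 : ‖x‖ + r < n := (Nat.le_ceil _).trans_lt (by exact_mod_cast hn)
      linarith
  let B := ∫ x, φ x ^ 2
  have hB : 0 ≤ B := integral_nonneg fun x => sq_nonneg _
  -- expansion of `0 ≤ ∫ (q 1_S - t φₙ)²`
  have quad : ∀ t : ℝ, ∀ n, 0 ≤ (∫ x in Ω, (S n).indicator (fun x => q x ^ 2) x)
      + (t ^ 2 * B - 2 * t * c) := by
    intro t n
    have i1 : Integrable ((S n).indicator (fun x => q x ^ 2)) (volume.restrict Ω) :=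
      hq.integrable_sq.indicator (hS n)
    have i2 : Integrable (fun x => φ (x - (n : ℝ) • e) ^ 2) (volume.restrict Ω) :=
      (((ht n).memLp 2).restrict Ω).integrable_sq
    have i3 := (ht n).integrableOn_mul hl
    have e2 : ∫ x in Ω, φ (x - (n : ℝ) • e) ^ 2 = B := by
      have := (ht n).setIntegral_eq (fun x => φ (x - (n : ℝ) • e))
      simp only [← pow_two] at this
      rw [this]
      exact integral_sub_right_eq_self (fun x => φ x ^ 2) _
    have e3 : ∫ x in Ω, q x * φ (x - (n : ℝ) • e) = c := hgc n
    have i4 : Integrable (fun x => t ^ 2 * φ (x - (n : ℝ) • e) ^ 2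
        - 2 * t * (q x * φ (x - (n : ℝ) • e))) (volume.restrict Ω) :=
      (i2.const_mul _).sub (i3.const_mul _)
    rw [← e3, ← e2, ← integral_const_mul, ← integral_const_mul,
      ← integral_sub (i2.const_mul _) (i3.const_mul _), ← integral_add i1 i4]
    refine integral_nonneg fun x => ?_
    by_cases hx : x ∈ S n
    · simp only [Set.indicator_of_mem hx, Pi.zero_apply]
      nlinarith [sq_nonneg (q x - t * φ (x - (n : ℝ) • e))]
    · have h0 : φ (x - (n : ℝ) • e) = 0 := by simpa [S] using hx
      simp [Set.indicator_of_notMem hx, h0]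
  have lim : ∀ t : ℝ, 0 ≤ t ^ 2 * B - 2 * t * c := fun t =>
    ge_of_tendsto' (by simpa using hA.add_const (t ^ 2 * B - 2 * t * c)) (quad t)
  have := lim (c / (B + 1))
  have e4 : (c / (B + 1)) ^ 2 * B - 2 * (c / (B + 1)) * c =
      -(c ^ 2 * (B + 2)) / (B + 1) ^ 2 := by field_simp; ring
  rw [e4, le_div_iff₀ (by positivity)] at this
  have h0 : c ^ 2 = 0 := by nlinarith [sq_nonneg c, mul_nonneg (sq_nonneg c) hB]
  simpa using h0

/-! ### Poincaré inequalities on the annulus -/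

/-- The Poincaré inequality passes from test functions to `H¹₀`. -/
theorem IsH10.mul_integral_sq_le {Ω : Set E3} (hΩ : MeasurableSet Ω) {c : ℝ}
    (hc : ∀ φ, IsTestFunction Ω φ →
      c * ∫ x in Ω, φ x ^ 2 ≤ ∫ x in Ω, ∑ j, pd j φ x ^ 2)
    {v : E3 → E3} {Dv : E3 → Matrix (Fin 3) (Fin 3) ℝ} (hv : IsH10 Ω v Dv) :
    c * ∫ x in Ω, ∑ i, v x i ^ 2 ≤ ∫ x in Ω, ∑ i, ∑ j, Dv x i j ^ 2 := by
  obtain ⟨φ, hφ, H0, H1, -⟩ := hv.exists_approx hΩ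
  have T0 := TendstoLp.sum Finset.univ le_rfl fun i _ => (H0 i).mul le_rfl (H0 i)
  have T1 := TendstoLp.sum Finset.univ le_rfl fun i _ =>
    TendstoLp.sum Finset.univ le_rfl fun j _ => (H1 i j).mul le_rfl (H1 i j)
  simp only [← pow_two] at T0 T1
  refine le_of_tendsto_of_tendsto' (T0.tendsto_integral.const_mul c) T1.tendsto_integral fun n => ?_
  have I0 : ∀ i, Integrable (fun x => φ n i x ^ 2) (volume.restrict Ω) :=
    fun i => (((hφ n i).memLp 2).restrict Ω).integrable_sq
  have I1 : ∀ i, Integrable (fun x => ∑ j, pd j (φ n i) x ^ 2) (volume.restrict Ω) :=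
    fun i => integrable_finsetSum _ fun j _ =>
      ((((hφ n i).pd j).memLp 2).restrict Ω).integrable_sq
  rw [integral_finsetSum _ fun i _ => I0 i, integral_finsetSum _ fun i _ => I1 i, Finset.mul_sum]
  exact Finset.sum_le_sum fun i _ => hc _ (hφ n i)

/-- Poincaré inequality in a slab of half-width `R`, with the sharp constant: the completed square
`(∂ⱼφ + k tan(k xⱼ) φ)²` has nonnegative integral. -/
theorem slab_poincare {Ω : Set E3} (hΩ : MeasurableSet Ω) {R : ℝ} (hR : 0 < R) {j : Fin 3}
    (hslab : ∀ x ∈ Ω, |x j| < R) {φ : E3 → ℝ} (hφ : IsTestFunction Ω φ) :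
    (Real.pi / (2 * R)) ^ 2 * ∫ x in Ω, φ x ^ 2 ≤ ∫ x in Ω, pd j φ x ^ 2 := by
  set k := Real.pi / (2 * R) with hk
  have hk0 : 0 < k := by positivity
  have hcos : ∀ x ∈ Ω, Real.cos (k * x j) ≠ 0 := by
    intro x hx
    refine (Real.cos_pos_of_mem_Ioo ?_).ne'
    rw [Set.mem_Ioo, ← abs_lt, abs_mul, abs_of_pos hk0]
    calc k * |x j| < k * R := by gcongr; exact hslab x hx
      _ = Real.pi / 2 := by rw [hk]; field_simp
  have hc : Continuous fun x : E3 => k * x j := by fun_prop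
  have hcW : ContinuousOn (fun x : E3 => Real.tan (k * x j)) Ω := by
    simp only [Real.tan_eq_sin_div_cos]
    exact (Real.continuous_sin.comp hc).continuousOn.div
      (Real.continuous_cos.comp hc).continuousOn hcos
  have hW := integral_mul_pd_eq_neg hΩ (f := fun x => k * Real.tan (k * x j))
    (f' := fun x => k ^ 2 * (1 + Real.tan (k * x j) ^ 2)) (j := j) (by fun_prop) (by fun_prop)
    (fun x hx => ?_) hφ.sq
  · have i1 : IntegrableOn (fun x => pd j φ x ^ 2) Ω :=
      (((hφ.pd j).memLp 2).restrict Ω).integrable_sq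
    have i2 : IntegrableOn (fun x => φ x ^ 2) Ω := ((hφ.memLp 2).restrict Ω).integrable_sq
    have i3 : IntegrableOn (fun x => k * Real.tan (k * x j) * pd j (fun y => φ y ^ 2) x) Ω :=
      ContinuousOn.integrableOn_mul_test hΩ (by fun_prop) (hφ.sq.pd j)
    have i4 : IntegrableOn (fun x => k ^ 2 * (1 + Real.tan (k * x j) ^ 2) * φ x ^ 2) Ω :=
      ContinuousOn.integrableOn_mul_test hΩ (by fun_prop) hφ.sq
    have i34 : IntegrableOn (fun x => k * Real.tan (k * x j) * pd j (fun y => φ y ^ 2) x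
        + k ^ 2 * (1 + Real.tan (k * x j) ^ 2) * φ x ^ 2) Ω := i3.add i4
    have h0 : 0 ≤ ∫ x in Ω, (pd j φ x ^ 2 - k ^ 2 * φ x ^ 2
        + (k * Real.tan (k * x j) * pd j (fun y => φ y ^ 2) x
        + k ^ 2 * (1 + Real.tan (k * x j) ^ 2) * φ x ^ 2)) := by
      refine integral_nonneg fun x => ?_
      have : pd j φ x ^ 2 - k ^ 2 * φ x ^ 2
        + (k * Real.tan (k * x j) * pd j (fun y => φ y ^ 2) x
        + k ^ 2 * (1 + Real.tan (k * x j) ^ 2) * φ x ^ 2) =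
          (pd j φ x + k * Real.tan (k * x j) * φ x) ^ 2 := by rw [hφ.pd_sq]; ring
      simp only [Pi.zero_apply]
      rw [this]; positivity
    have i12 : IntegrableOn (fun x => pd j φ x ^ 2 - k ^ 2 * φ x ^ 2) Ω :=
      i1.sub (i2.const_mul _)
    rw [integral_add i12 i34, integral_add i3 i4, integral_sub i1 (i2.const_mul _), hW,
      integral_const_mul] at h0
    linarith
  · have h1 := (hasDerivAt_coord j x j).const_mul k
    have h2 : HasDerivAt Real.tan (1 + Real.tan (k * x j) ^ 2)
        (k * (x + (0 : ℝ) • EuclideanSpace.single j (1 : ℝ)) j) := by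
      have := Real.hasDerivAt_tan (hcos x hx)
      rw [← Real.inv_one_add_tan_sq (hcos x hx)] at this
      simpa using this
    refine ((h2.comp (0 : ℝ) h1).const_mul k).congr_deriv ?_
    simp; ring

/-- The annulus is contained in two perpendicular slabs of half-width `R₂`. -/
theorem annulus_poincare_pi {R₁ R₂ : ℝ} (hR₂ : 0 < R₂) {φ : E3 → ℝ}
    (hφ : IsTestFunction (annulus R₁ R₂) φ) :
    Real.pi ^ 2 / (2 * R₂ ^ 2) * ∫ x in annulus R₁ R₂, φ x ^ 2 ≤
      ∫ x in annulus R₁ R₂, ∑ j, pd j φ x ^ 2 := by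
  have hm := (isOpen_annulus R₁ R₂).measurableSet
  have h0 := slab_poincare hm hR₂ (j := 0) (fun x hx => by
    refine abs_lt_of_sq_lt_sq ?_ hR₂.le
    nlinarith [hx.2, sq_nonneg (x 1)]) hφ
  have h1 := slab_poincare hm hR₂ (j := 1) (fun x hx => by
    refine abs_lt_of_sq_lt_sq ?_ hR₂.le
    nlinarith [hx.2, sq_nonneg (x 0)]) hφ
  have h2 : 0 ≤ ∫ x in annulus R₁ R₂, pd 2 φ x ^ 2 := integral_nonneg fun x => sq_nonneg _
  rw [integral_finsetSum _ fun j _ => (((hφ.pd j).memLp 2).restrict _).integrable_sq,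
    Fin.sum_univ_three]
  have e : Real.pi ^ 2 / (2 * R₂ ^ 2) = (Real.pi / (2 * R₂)) ^ 2 + (Real.pi / (2 * R₂)) ^ 2 := by
    field_simp; norm_num
  rw [e, add_mul]
  linarith

/-- A one-dimensional Lyapunov type inequality: twice the value of a function vanishing at both
ends is at most the total variation, which the Cauchy–Schwarz inequality controls by the energy
with weight `r`. -/
theorem sq_le_log_mul_integral {R₁ R₂ : ℝ} (h₁ : 0 < R₁) (h₂ : R₁ < R₂) {g g' : ℝ → ℝ}
    (hg : ∀ r, HasDerivAt g (g' r) r) (hg' : Continuous g') (e₁ : g R₁ = 0) (e₂ : g R₂ = 0)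
    {r : ℝ} (hr : r ∈ Set.Icc R₁ R₂) :
    g r ^ 2 ≤ Real.log (R₂ / R₁) / 4 * ∫ s in R₁..R₂, s * g' s ^ 2 := by
  have hi : ∀ a b, IntervalIntegrable g' volume a b := fun a b => hg'.intervalIntegrable a b
  have hL : 0 < Real.log (R₂ / R₁) := Real.log_pos ((one_lt_div h₁).2 h₂)
  set L := Real.log (R₂ / R₁)
  set I := ∫ s in R₁..R₂, |g' s| with hI
  have b1 : |g r| ≤ ∫ s in R₁..r, |g' s| := by
    have := intervalIntegral.integral_eq_sub_of_hasDerivAt (fun s _ => hg s) (hi R₁ r)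
    rw [e₁, sub_zero] at this
    rw [← this]
    exact intervalIntegral.abs_integral_le_integral_abs hr.1
  have b2 : |g r| ≤ ∫ s in r..R₂, |g' s| := by
    have := intervalIntegral.integral_eq_sub_of_hasDerivAt (fun s _ => hg s) (hi r R₂)
    rw [e₂, zero_sub] at this
    rw [← abs_neg, ← this]
    exact intervalIntegral.abs_integral_le_integral_abs hr.2
  have b3 : (∫ s in R₁..r, |g' s|) + ∫ s in r..R₂, |g' s| = I :=
    intervalIntegral.integral_add_adjacent_intervals (hi R₁ r).abs (hi r R₂).abs
  have b4 : 2 * |g r| ≤ I := by linarith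
  have hlog : ∫ s in R₁..R₂, s⁻¹ = L := integral_inv_of_pos h₁ (h₁.trans h₂)
  have iinv : IntervalIntegrable (fun s : ℝ => s⁻¹) volume R₁ R₂ := by
    refine intervalIntegral.intervalIntegrable_inv (fun s hs => ?_) continuousOn_id
    rw [Set.uIcc_of_le h₂.le] at hs
    exact (h₁.trans_le hs.1).ne'
  have iD : IntervalIntegrable (fun s => s * g' s ^ 2) volume R₁ R₂ :=
    (by fun_prop : Continuous fun s => s * g' s ^ 2).intervalIntegrable _ _
  have cs : ∀ c : ℝ, 0 ≤ (∫ s in R₁..R₂, s * g' s ^ 2) - 2 * c * I + c ^ 2 * L := by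
    intro c
    have ia : IntervalIntegrable (fun s => 2 * c * |g' s|) volume R₁ R₂ :=
      (hi R₁ R₂).abs.const_mul _
    rw [← hlog, hI, ← intervalIntegral.integral_const_mul, ← intervalIntegral.integral_const_mul,
      ← intervalIntegral.integral_sub iD ia,
      ← intervalIntegral.integral_add (iD.sub ia) (iinv.const_mul _)]
    refine intervalIntegral.integral_nonneg h₂.le fun s hs => ?_
    have hs0 : 0 < s := h₁.trans_le hs.1
    have : s * g' s ^ 2 - 2 * c * |g' s| + c ^ 2 * s⁻¹ = s * (|g' s| - c * s⁻¹) ^ 2 := by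
      rw [← sq_abs (g' s)]; field_simp; ring
    rw [this]; positivity
  have h := cs (I / L)
  have e : (∫ s in R₁..R₂, s * g' s ^ 2) - 2 * (I / L) * I + (I / L) ^ 2 * L =
      (∫ s in R₁..R₂, s * g' s ^ 2) - I ^ 2 / L := by field_simp; ring
  rw [e, sub_nonneg, div_le_iff₀ hL] at h
  have : (2 * |g r|) ^ 2 ≤ I ^ 2 := by gcongr
  rw [mul_pow, sq_abs] at this
  linarith

theorem integral_mul_sq_le {R₁ R₂ : ℝ} (h₁ : 0 < R₁) (h₂ : R₁ < R₂) {g g' : ℝ → ℝ}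
    (hg : ∀ r, HasDerivAt g (g' r) r) (hg' : Continuous g') (e₁ : g R₁ = 0) (e₂ : g R₂ = 0) :
    ∫ r in R₁..R₂, r * g r ^ 2 ≤ (R₂ ^ 2 - R₁ ^ 2) * Real.log (R₂ / R₁) / 8 *
      ∫ r in R₁..R₂, r * g' r ^ 2 := by
  have cg : Continuous g := continuous_iff_continuousAt.2 fun r => (hg r).continuousAt
  set D := ∫ s in R₁..R₂, s * g' s ^ 2 with hD
  calc ∫ r in R₁..R₂, r * g r ^ 2
      ≤ ∫ r in R₁..R₂, r * (Real.log (R₂ / R₁) / 4 * D) := by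
        refine intervalIntegral.integral_mono_on h₂.le
          (Continuous.intervalIntegrable (by fun_prop) _ _)
          (Continuous.intervalIntegrable (by fun_prop) _ _) fun r hr => ?_
        have := h₁.trans_le hr.1
        gcongr
        exact sq_le_log_mul_integral h₁ h₂ hg hg' e₁ e₂ hr
    _ = _ := by rw [intervalIntegral.integral_mul_const, integral_id]; ring

/-- Tonelli's theorem in cylindrical coordinates, for a function supported in the annulus. -/
theorem lintegral_cylindrical {R₁ R₂ : ℝ} (h₁ : 0 < R₁) (h₂ : R₁ < R₂) {F : E3 → ℝ}
    (hF : Continuous F) (hF0 : ∀ x, 0 ≤ F x) (hsupp : ∀ x ∉ annulus R₁ R₂, F x = 0) :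
    ∫⁻ x, ENNReal.ofReal (F x) = ∫⁻ z : ℝ, ∫⁻ θ in Set.Ioo (-Real.pi) Real.pi,
      ENNReal.ofReal (∫ r in R₁..R₂, r * F !₂[r * Real.cos θ, r * Real.sin θ, z]) := by
  have mp1 := (PiLp.volume_preserving_toLp (Fin 3)).lintegral_comp_emb
    (MeasurableEquiv.toLp 2 (Fin 3 → ℝ)).measurableEmbedding (fun x => ENNReal.ofReal (F x))
  have mp2 := (volume_preserving_piFinSuccAbove (fun _ : Fin 3 => ℝ) 2).symm.lintegral_comp_emb
    (MeasurableEquiv.measurableEmbedding _)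
    (fun x : Fin 3 → ℝ => ENNReal.ofReal (F (WithLp.toLp 2 x)))
  rw [← mp1, ← mp2]
  have mz : Measurable fun x : ℝ × (Fin 2 → ℝ) => ENNReal.ofReal (F (WithLp.toLp 2
      ((MeasurableEquiv.piFinSuccAbove (fun _ : Fin 3 => ℝ) 2).symm x))) :=
    (hF.measurable.comp ((PiLp.continuous_toLp 2 _).measurable.comp
      (MeasurableEquiv.measurable _))).ennreal_ofReal
  rw [Measure.volume_eq_prod, lintegral_prod _ mz.aemeasurable]
  refine lintegral_congr fun z => ?_
  have mp3 := (volume_preserving_finTwoArrow ℝ).symm.lintegral_comp_emb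
    (MeasurableEquiv.measurableEmbedding _)
    (fun y : Fin 2 → ℝ => ENNReal.ofReal (F (WithLp.toLp 2
      ((MeasurableEquiv.piFinSuccAbove (fun _ : Fin 3 => ℝ) 2).symm (z, y)))))
  refine mp3.symm.trans ?_
  have e : ∀ p : ℝ × ℝ, WithLp.toLp 2 ((MeasurableEquiv.piFinSuccAbove (fun _ : Fin 3 => ℝ) 2).symm
      (z, MeasurableEquiv.finTwoArrow.symm p)) = !₂[p.1, p.2, z] := by
    intro p
    ext i
    fin_cases i <;> rfl
  simp only [e]
  have cF : Continuous fun p : ℝ × ℝ => F !₂[p.1, p.2, z] := by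
    refine hF.comp ((PiLp.continuous_toLp 2 _).comp (continuous_pi fun i => ?_))
    fin_cases i <;> simp <;> fun_prop
  have cP : Continuous fun p : ℝ × ℝ => F !₂[p.1 * Real.cos p.2, p.1 * Real.sin p.2, z] :=
    cF.comp (f := fun p : ℝ × ℝ => (p.1 * Real.cos p.2, p.1 * Real.sin p.2)) (by fun_prop)
  have hpol : ∀ p : ℝ × ℝ, ENNReal.ofReal p.1 • ENNReal.ofReal
      (F !₂[(polarCoord.symm p).1, (polarCoord.symm p).2, z]) =
      ENNReal.ofReal p.1 * ENNReal.ofReal (F !₂[p.1 * Real.cos p.2, p.1 * Real.sin p.2, z]) := by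
    intro p; rw [polarCoord_symm_apply, smul_eq_mul]
  rw [← lintegral_comp_polarCoord_symm, polarCoord_target, Measure.volume_eq_prod]
  simp only [hpol]
  rw [setLIntegral_prod_symm _ (by
    have := cP.measurable.ennreal_ofReal
    exact (measurable_fst.ennreal_ofReal.mul this).aemeasurable)]
  refine lintegral_congr fun θ => ?_
  have cr : Continuous fun r : ℝ => r * F !₂[r * Real.cos θ, r * Real.sin θ, z] :=
    continuous_id.mul (cP.comp (f := fun r : ℝ => (r, θ)) (by fun_prop))
  rw [intervalIntegral.integral_of_le h₂.le, ofReal_integral_eq_lintegral_ofReal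
    (cr.intervalIntegrable R₁ R₂).1 ((ae_restrict_mem measurableSet_Ioc).mono fun r hr =>
      mul_nonneg (h₁.trans hr.1).le (hF0 _)),
    ← lintegral_indicator measurableSet_Ioi, ← lintegral_indicator measurableSet_Ioc]
  refine lintegral_congr fun r => ?_
  by_cases hr : r ∈ Set.Ioc R₁ R₂
  · rw [Set.indicator_of_mem hr, Set.indicator_of_mem (Set.mem_Ioi.2 (h₁.trans hr.1)),
      ENNReal.ofReal_mul (h₁.trans hr.1).le]
  · rw [Set.indicator_of_notMem hr]
    by_cases hr0 : r ∈ Set.Ioi (0 : ℝ)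
    · have h0 : 0 < r := hr0
      rw [Set.indicator_of_mem hr0, hsupp, ENNReal.ofReal_zero, mul_zero]
      rintro ⟨ha, hb⟩
      have hcs : (r * Real.cos θ) ^ 2 + (r * Real.sin θ) ^ 2 = r ^ 2 := by
        linear_combination r ^ 2 * Real.sin_sq_add_cos_sq θ
      simp [hcs] at ha hb
      exact hr ⟨lt_of_pow_lt_pow_left₀ 2 h0.le ha,
        (lt_of_pow_lt_pow_left₀ 2 (h₁.trans h₂).le hb).le⟩
    · rw [Set.indicator_of_notMem hr0]

/-- The Poincaré inequality obtained from `integral_mul_sq_le` on every horizontal ray. -/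
theorem annulus_poincare_log {R₁ R₂ : ℝ} (h₁ : 0 < R₁) (h₂ : R₁ < R₂) {φ : E3 → ℝ}
    (hφ : IsTestFunction (annulus R₁ R₂) φ) :
    8 / ((R₂ ^ 2 - R₁ ^ 2) * Real.log (R₂ / R₁)) * ∫ x in annulus R₁ R₂, φ x ^ 2 ≤
      ∫ x in annulus R₁ R₂, ∑ j, pd j φ x ^ 2 := by
  have hL : 0 < Real.log (R₂ / R₁) := Real.log_pos ((one_lt_div h₁).2 h₂)
  have hd : 0 < R₂ ^ 2 - R₁ ^ 2 := by nlinarith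
  set C := (R₂ ^ 2 - R₁ ^ 2) * Real.log (R₂ / R₁) / 8 with hC
  have hC0 : 0 < C := by positivity
  have hz : ∀ x ∉ annulus R₁ R₂, φ x ^ 2 = 0 := fun x hx => by simp [hφ.eq_zero_of_notMem hx]
  have hz' : ∀ x ∉ annulus R₁ R₂, pd 0 φ x ^ 2 + pd 1 φ x ^ 2 = 0 := fun x hx => by
    simp [(hφ.pd _).eq_zero_of_notMem hx]
  have c0 := hφ.continuous
  have cd := hφ.continuous_pd
  -- the planar part of the gradient suffices
  have key : ∫ x, φ x ^ 2 ≤ C * ∫ x, (pd 0 φ x ^ 2 + pd 1 φ x ^ 2) := by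
    have i0 : Integrable (fun x => φ x ^ 2) := (hφ.memLp 2).integrable_sq
    have i1 : Integrable (fun x => pd 0 φ x ^ 2 + pd 1 φ x ^ 2) :=
      ((hφ.pd 0).memLp 2).integrable_sq.add ((hφ.pd 1).memLp 2).integrable_sq
    have n1 : 0 ≤ ∫ x, (pd 0 φ x ^ 2 + pd 1 φ x ^ 2) := integral_nonneg fun x => by positivity
    rw [← ENNReal.ofReal_le_ofReal_iff (by positivity), ENNReal.ofReal_mul hC0.le,
      ofReal_integral_eq_lintegral_ofReal i0 (Eventually.of_forall fun x => by positivity),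
      ofReal_integral_eq_lintegral_ofReal i1 (Eventually.of_forall fun x => by positivity),
      lintegral_cylindrical h₁ h₂ (by fun_prop) (fun x => by positivity) hz,
      lintegral_cylindrical h₁ h₂ (by fun_prop) (fun x => by positivity) hz',
      ← lintegral_const_mul' _ _ ENNReal.ofReal_ne_top]
    refine lintegral_mono fun z => ?_
    rw [← lintegral_const_mul' _ _ ENNReal.ofReal_ne_top]
    refine lintegral_mono fun θ => ?_
    rw [← ENNReal.ofReal_mul hC0.le]
    refine ENNReal.ofReal_le_ofReal ?_
    -- the restriction of `φ` to a horizontal ray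
    let γ : ℝ → E3 := fun r => !₂[r * Real.cos θ, r * Real.sin θ, z]
    let d : E3 := !₂[Real.cos θ, Real.sin θ, 0]
    have hγ : ∀ r, HasDerivAt γ d r := by
      intro r
      have e : γ = fun r => !₂[0, 0, z] + r • d := by
        funext r
        ext i
        fin_cases i <;> simp [γ, d]
      rw [e]
      simpa using ((hasDerivAt_id r).smul_const d).const_add !₂[0, 0, z]
    have cγ : Continuous γ := continuous_iff_continuousAt.2 fun r => (hγ r).continuousAt
    have hd' : d = Real.cos θ • EuclideanSpace.single 0 1
        + Real.sin θ • EuclideanSpace.single 1 1 := by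
      ext i
      fin_cases i <;> simp [d]
    have hg : ∀ r, HasDerivAt (fun r => φ (γ r))
        (Real.cos θ * pd 0 φ (γ r) + Real.sin θ * pd 1 φ (γ r)) r := by
      intro r
      refine ((hφ.differentiable (γ r)).hasFDerivAt.comp_hasDerivAt r (hγ r)).congr_deriv ?_
      rw [hd']
      simp [pd]
    have hend : ∀ r, r ^ 2 = R₁ ^ 2 ∨ r ^ 2 = R₂ ^ 2 → φ (γ r) = 0 := by
      intro r hr
      refine hφ.eq_zero_of_notMem ?_
      rintro ⟨ha, hb⟩
      have hcs : (r * Real.cos θ) ^ 2 + (r * Real.sin θ) ^ 2 = r ^ 2 := by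
        linear_combination r ^ 2 * Real.sin_sq_add_cos_sq θ
      simp [γ, hcs] at ha hb
      rcases hr with hr | hr <;> linarith
    refine (integral_mul_sq_le h₁ h₂ hg (by fun_prop) (hend _ (Or.inl rfl))
      (hend _ (Or.inr rfl))).trans (mul_le_mul_of_nonneg_left ?_ hC0.le)
    refine intervalIntegral.integral_mono_on h₂.le
      (Continuous.intervalIntegrable (by fun_prop) _ _)
      (Continuous.intervalIntegrable (u := fun r => r * (pd 0 φ (γ r) ^ 2 + pd 1 φ (γ r) ^ 2))
        (by fun_prop) _ _) fun r hr => ?_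
    refine mul_le_mul_of_nonneg_left ?_ (h₁.trans_le hr.1).le
    change _ ≤ pd 0 φ (γ r) ^ 2 + pd 1 φ (γ r) ^ 2
    nlinarith [sq_nonneg (Real.sin θ * pd 0 φ (γ r) - Real.cos θ * pd 1 φ (γ r)),
      Real.sin_sq_add_cos_sq θ]
  rw [← setIntegral_eq_integral_of_forall_compl_eq_zero hz,
    ← setIntegral_eq_integral_of_forall_compl_eq_zero hz'] at key
  have mono : ∫ x in annulus R₁ R₂, (pd 0 φ x ^ 2 + pd 1 φ x ^ 2) ≤
      ∫ x in annulus R₁ R₂, ∑ j, pd j φ x ^ 2 := by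
    have i : ∀ j, Integrable (fun x => pd j φ x ^ 2) (volume.restrict (annulus R₁ R₂)) :=
      fun j => (((hφ.pd j).memLp 2).restrict _).integrable_sq
    refine integral_mono ((i 0).add (i 1)) (integrable_finsetSum _ fun j _ => i j) fun x => ?_
    simp only [Fin.sum_univ_three]
    nlinarith [sq_nonneg (pd 2 φ x)]
  have e : 8 / ((R₂ ^ 2 - R₁ ^ 2) * Real.log (R₂ / R₁)) = C⁻¹ := by rw [hC, inv_div]
  rw [e, inv_mul_le_iff₀ hC0]
  exact key.trans (mul_le_mul_of_nonneg_left mono hC0.le)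

/-! ### Uniqueness -/

theorem isBoundedFlow_flow {R₁ R₂ : ℝ} (h₁ : 0 < R₁) (a b k K : ℝ) :
    IsBoundedFlow (annulus R₁ R₂) (flow a b k K R₁) (flowGrad a b k K) (flowPressure a b k) := by
  have h0 : ∀ x ∈ annulus R₁ R₂, rhoSq x ≠ 0 := fun x hx => (rhoSq_pos hx).ne'
  have h0' : ∀ x ∈ {x | R₁ ^ 2 ≤ rhoSq x ∧ rhoSq x ≤ R₂ ^ 2}, rhoSq x ≠ 0 :=
    fun x hx => ((by positivity : 0 < R₁ ^ 2).trans_le hx.1).ne'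
  refine ⟨continuousOn_flow a b k K R₁ h0, continuousOn_flowGrad a b k K h0,
    continuousOn_flowPressure a b k h0,
    fun i => exists_bound_of_vertical_invariant (continuousOn_flow a b k K R₁ h0' i) fun x => ?_,
    fun i j => exists_bound_of_vertical_invariant (continuousOn_flowGrad a b k K h0' i j)
      fun x => ?_,
    fun i j x hx => hasLineDerivAt_flow j (h0 x hx) a b k K R₁ i,
    fun i φ hφ => integral_flow_momentum (isOpen_annulus R₁ R₂).measurableSet h0 a b k K R₁ i hφ⟩
  · simp [flow, rhoSq]
  · simp [flowGrad, rhoSq]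

theorem IsH1.integrable_sq_sum {Ω : Set E3} {v : E3 → E3} {Dv : E3 → Matrix (Fin 3) (Fin 3) ℝ}
    (hv : IsH1 Ω v Dv) : IntegrableOn (fun x => ∑ i, v x i ^ 2) Ω :=
  integrable_finsetSum _ fun i _ => (hv.memLp i).integrable_sq

theorem IsH1.ae_eq_zero_iff {Ω : Set E3} {v : E3 → E3} {Dv : E3 → Matrix (Fin 3) (Fin 3) ℝ}
    (hv : IsH1 Ω v Dv) : v =ᵐ[volume.restrict Ω] 0 ↔ ∫ x in Ω, ∑ i, v x i ^ 2 = 0 := by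
  rw [integral_eq_zero_iff_of_nonneg (fun x => by positivity) hv.integrable_sq_sum]
  refine ⟨fun h => h.mono fun x hx => by simp [hx], fun h => h.mono fun x hx => ?_⟩
  simp only [Pi.zero_apply] at hx
  rw [Finset.sum_eq_zero_iff_of_nonneg fun i _ => sq_nonneg _] at hx
  ext i
  simpa using hx i (Finset.mem_univ i)

/-- The defining inequality of the Poincaré constant; it holds trivially for `v = 0`. -/
theorem poincareConst_mul_le {Ω : Set E3} {v : E3 → E3} {Dv : E3 → Matrix (Fin 3) (Fin 3) ℝ}
    (hv : IsV0 Ω v Dv) :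
    poincareConst Ω * ∫ x in Ω, ∑ i, v x i ^ 2 ≤ ∫ x in Ω, ∑ i, ∑ j, Dv x i j ^ 2 := by
  have hD : 0 ≤ ∫ x in Ω, ∑ i, ∑ j, Dv x i j ^ 2 := integral_nonneg fun x => by positivity
  by_cases h : v =ᵐ[volume.restrict Ω] 0
  · rw [hv.isH10.isH1.ae_eq_zero_iff.1 h, mul_zero]
    exact hD
  · have hN : 0 < ∫ x in Ω, ∑ i, v x i ^ 2 :=
      lt_of_le_of_ne (integral_nonneg fun x => by positivity)
        fun h0 => h (hv.isH10.isH1.ae_eq_zero_iff.2 h0.symm)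
    rw [← le_div_iff₀ hN]
    refine csInf_le ⟨0, ?_⟩ ⟨v, Dv, hv, h, rfl⟩
    rintro r ⟨w, Dw, -, -, rfl⟩
    exact div_nonneg (integral_nonneg fun x => by positivity)
      (integral_nonneg fun x => by positivity)

section uniqueness

variable {R₁ R₂ α β : ℝ} {v : E3 → E3} {q : E3 → ℝ}
  {Dv : E3 → Matrix (Fin 3) (Fin 3) ℝ}

/-- The energy of a perturbation of the spiral Poiseuille flow is controlled by the shear. -/
theorem integral_grad_sq_le_Mout (h₁ : 0 < R₁) (h₂ : R₁ < R₂)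
    (hv : IsV0 (annulus R₁ R₂) v Dv)
    (hq : MemLp q 2 (volume.restrict (annulus R₁ R₂)))
    (hsol : IsWeakNavierStokes (annulus R₁ R₂) (fun x => spiralVelocity R₁ R₂ α β x + v x)
      (fun x => spiralPressure R₁ R₂ α β x + q x)) :
    ∫ x in annulus R₁ R₂, ∑ i, ∑ j, Dv x i j ^ 2 ≤
      Mout R₁ R₂ α β * ∫ x in annulus R₁ R₂, ∑ i, v x i ^ 2 := by
  have hΩ := isOpen_annulus R₁ R₂
  obtain ⟨Du, hu, -, -, hNS, hdiv⟩ := hsol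
  obtain ⟨hint, he⟩ := energy_identity hΩ (isBoundedFlow_flow h₁ (spiralRotation R₁ R₂ α) (β / 4)
    (spiralRotation R₁ R₂ α * R₂ ^ 2) (twoLogMean R₁ R₂)) hv hq hu hNS hdiv
    (fun x hx i => by simp [spiralVelocity_eq_flow h₁ α β (rhoSq_pos hx)])
    (fun x hx => by rw [spiralPressure_eq_flowPressure α β (rhoSq_pos hx)])
  rw [he, ← integral_neg, ← integral_const_mul]
  refine setIntegral_mono_on hint.neg (hv.isH10.isH1.integrable_sq_sum.const_mul _)
    hΩ.measurableSet fun x hx => ?_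
  exact (neg_le_abs _).trans (abs_flowGrad_quadratic_le_Mout h₁ h₂ α β hx (fun i => v x i))

/-- If the velocity perturbation vanishes then so does the pressure perturbation. -/
theorem pressure_ae_eq_zero (h₁ : 0 < R₁) (hv : IsV0 (annulus R₁ R₂) v Dv)
    (hq : MemLp q 2 (volume.restrict (annulus R₁ R₂)))
    (hsol : IsWeakNavierStokes (annulus R₁ R₂) (fun x => spiralVelocity R₁ R₂ α β x + v x)
      (fun x => spiralPressure R₁ R₂ α β x + q x))
    (hv0 : v =ᵐ[volume.restrict (annulus R₁ R₂)] 0)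
    (hDv0 : ∫ x in annulus R₁ R₂, ∑ i, ∑ j, Dv x i j ^ 2 ≤ 0) :
    q =ᵐ[volume.restrict (annulus R₁ R₂)] 0 := by
  have hΩ := isOpen_annulus R₁ R₂
  obtain ⟨Du, hu, -, -, hNS, -⟩ := hsol
  have hU := isBoundedFlow_flow (R₂ := R₂) h₁ (spiralRotation R₁ R₂ α) (β / 4)
    (spiralRotation R₁ R₂ α * R₂ ^ 2) (twoLogMean R₁ R₂)
  have huv : ∀ x ∈ annulus R₁ R₂, ∀ i, (spiralVelocity R₁ R₂ α β x + v x) i =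
      flow (spiralRotation R₁ R₂ α) (β / 4) (spiralRotation R₁ R₂ α * R₂ ^ 2) (twoLogMean R₁ R₂)
        R₁ i x + v x i :=
    fun x hx i => by simp [spiralVelocity_eq_flow h₁ α β (rhoSq_pos hx)]
  have hD := weakGradient_ae_eq_add hΩ hU hv.isH10.isH1.hasWeakGradient hu huv
  have hDv : ∀ᵐ x ∂(volume.restrict (annulus R₁ R₂)), ∀ i j, Dv x i j = 0 := by
    have h0 := le_antisymm hDv0 (integral_nonneg fun x => by positivity)
    rw [integral_eq_zero_iff_of_nonneg (fun x => by positivity)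
      (integrable_finsetSum _ fun i _ => integrable_finsetSum _ fun j _ =>
        (hv.isH10.isH1.memLp_grad i j).integrable_sq)] at h0
    filter_upwards [h0] with x hx i j
    simp only [Pi.zero_apply] at hx
    rw [Finset.sum_eq_zero_iff_of_nonneg fun i _ => by positivity] at hx
    have := hx i (Finset.mem_univ i)
    rw [Finset.sum_eq_zero_iff_of_nonneg fun i _ => by positivity] at this
    simpa using this j (Finset.mem_univ j)
  refine ae_eq_zero_of_integral_mul_pd_eq_zero hΩ (j := 2) (fun x hx s => ?_) hq fun φ hφ => ?_
  · simpa [annulus] using hx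
  have hae : (fun x => ∑ j, Dv x 2 j * pd j φ x
      + ∑ j, ((flow (spiralRotation R₁ R₂ α) (β / 4) (spiralRotation R₁ R₂ α * R₂ ^ 2)
        (twoLogMean R₁ R₂) R₁ j x + v x j) * φ x) * Dv x 2 j
      + ∑ j, (v x j * flowGrad (spiralRotation R₁ R₂ α) (β / 4)
        (spiralRotation R₁ R₂ α * R₂ ^ 2) (twoLogMean R₁ R₂) x 2 j) * φ x
      - q x * pd 2 φ x) =ᵐ[volume.restrict (annulus R₁ R₂)] fun x => -(q x * pd 2 φ x) := by
    filter_upwards [hv0, hDv] with x hx hx'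
    simp [hx, hx']
  have hi : Integrable (fun x => q x * pd 2 φ x) (volume.restrict (annulus R₁ R₂)) :=
    hq.integrable_mul (((hφ.pd 2).memLp 2).restrict _)
  have := integral_perturbation_eq_zero hΩ hU hD huv
    (fun x hx => by rw [spiralPressure_eq_flowPressure α β (rhoSq_pos hx)]) hφ (hNS 2 φ hφ)
    (hi.neg.congr hae.symm)
  rw [integral_congr_ae hae, integral_neg, neg_eq_zero] at this
  exact this

/-- A perturbation vanishes as soon as it satisfies a Poincaré inequality with a constant that
exceeds the shear. -/
theorem perturbation_ae_eq_zero (h₁ : 0 < R₁) (h₂ : R₁ < R₂) (hv : IsV0 (annulus R₁ R₂) v Dv)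
    (hq : MemLp q 2 (volume.restrict (annulus R₁ R₂)))
    (hsol : IsWeakNavierStokes (annulus R₁ R₂) (fun x => spiralVelocity R₁ R₂ α β x + v x)
      (fun x => spiralPressure R₁ R₂ α β x + q x)) {c : ℝ} (hMc : Mout R₁ R₂ α β < c)
    (hc : c * ∫ x in annulus R₁ R₂, ∑ i, v x i ^ 2 ≤
      ∫ x in annulus R₁ R₂, ∑ i, ∑ j, Dv x i j ^ 2) :
    v =ᵐ[volume.restrict (annulus R₁ R₂)] 0 ∧ q =ᵐ[volume.restrict (annulus R₁ R₂)] 0 := by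
  have hE := integral_grad_sq_le_Mout h₁ h₂ hv hq hsol
  have hN : 0 ≤ ∫ x in annulus R₁ R₂, ∑ i, v x i ^ 2 := integral_nonneg fun x => by positivity
  have h0 : ∫ x in annulus R₁ R₂, ∑ i, v x i ^ 2 = 0 := by nlinarith
  have hv0 := hv.isH10.isH1.ae_eq_zero_iff.2 h0
  rw [h0, mul_zero] at hE
  exact ⟨hv0, pressure_ae_eq_zero h₁ hv hq hsol hv0 hE⟩

end uniqueness

end SpiralPoiseuille

theorem theorem3p3 (R₁ R₂ : ℝ) (hR₁ : 0 < R₁) (hR₁R₂ : R₁ < R₂) (α β : ℝ)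
    (v : SpiralPoiseuille.E3 → SpiralPoiseuille.E3) (q : SpiralPoiseuille.E3 → ℝ)
    (hv : SpiralPoiseuille.MemV0 (SpiralPoiseuille.annulus R₁ R₂) v)
    (hq : MemLp q 2 (volume.restrict (SpiralPoiseuille.annulus R₁ R₂)))
    (hsol : SpiralPoiseuille.SolvesStillOuter R₁ R₂ α
      (fun x => SpiralPoiseuille.spiralVelocity R₁ R₂ α β x + v x)
      (fun x => SpiralPoiseuille.spiralPressure R₁ R₂ α β x + q x)) :
    (SpiralPoiseuille.Mout R₁ R₂ α β
        < SpiralPoiseuille.poincareConst (SpiralPoiseuille.annulus R₁ R₂) →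
      v =ᵐ[volume.restrict (SpiralPoiseuille.annulus R₁ R₂)] 0 ∧
      q =ᵐ[volume.restrict (SpiralPoiseuille.annulus R₁ R₂)] 0) ∧
    (SpiralPoiseuille.Mout R₁ R₂ α β
        < max (Real.pi ^ 2 / (2 * R₂ ^ 2)) (8 / ((R₂ ^ 2 - R₁ ^ 2) * Real.log (R₂ / R₁))) →
      v =ᵐ[volume.restrict (SpiralPoiseuille.annulus R₁ R₂)] 0 ∧
      q =ᵐ[volume.restrict (SpiralPoiseuille.annulus R₁ R₂)] 0) := by
  obtain ⟨Dv, hV⟩ := hv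
  have hm := (SpiralPoiseuille.isOpen_annulus R₁ R₂).measurableSet
  have main := fun c (hMc : SpiralPoiseuille.Mout R₁ R₂ α β < c) =>
    SpiralPoiseuille.perturbation_ae_eq_zero hR₁ hR₁R₂ hV hq hsol.navierStokes hMc
  refine ⟨fun hM => main _ hM (SpiralPoiseuille.poincareConst_mul_le hV), fun hM => ?_⟩
  rcases lt_max_iff.1 hM with hM | hM
  · exact main _ hM (hV.isH10.mul_integral_sq_le hm fun φ hφ =>
      SpiralPoiseuille.annulus_poincare_pi (hR₁.trans hR₁R₂) hφ)
  · exact main _ hM (hV.isH10.mul_integral_sq_le hm fun φ hφ =>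
      SpiralPoiseuille.annulus_poincare_log hR₁ hR₁R₂ hφ)
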